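/- **Language.** Terms are built from countably infinitely many individual variables by a unary symbol $-$ and a binary symbol $+$. Formulas are built from the atomic formulas $a\equiv b$ and $C(a,b)$ ($a,b$ terms) by $\neg$ and $\vee$. As abbreviations, $\varphi\Rightarrow\psi$ is $\neg\varphi\vee\psi$; $\varphi\wedge\psi$ is $\neg(\neg\varphi\vee\neg\psi)$; $\varphi\Leftrightarrow\psi$ is $(\varphi\Rightarrow\psi)\wedge(\psi\Rightarrow\varphi)$; $a\not\equiv b$ is $\neg(a\equiv b)$; $a\cdot b$ is $-((-a)+(-b))$; $0$ is $p\cdot(-p)$ for a fixed variable $p$; $1$ is $-0$. **Formal system $\mathfrak F$.** The only rule is modus ponens. The axioms are all instances of: 1. a complete set of schemes for classical propositional logic: $\varphi\Rightarrow(\psi\Rightarrow\varphi)$, $(\varphi\Rightarrow(\psi\Rightarrow\chi))\Rightarrow((\varphi\Rightarrow\psi)\Rightarrow(\varphi\Rightarrow\chi))$, $(\neg\varphi\Rightarrow\neg\psi)\Rightarrow(\psi\Rightarrow\varphi)$, $\varphi\Rightarrow(\varphi\vee\psi)$, $\psi\Rightarrow(\varphi\vee\psi)$, $(\varphi\Rightarrow\chi)\Rightarrow((\psi\Rightarrow\chi)\Rightarrow((\varphi\vee\psi)\Rightarrow\chi))$;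 2. equality: reflexivity, symmetry and transitivity of $\equiv$, and its compatibility with $-$, $+$ and $C$; 3. Boolean algebras: associativity, commutativity, absorption and distributivity for $+$ and $\cdot$, together with $a+(-a)\equiv 1$, $a\cdot(-a)\equiv 0$ and $0\not\equiv 1$; 4. contact: $\neg C(0,a)$; $C(a,b+c)\Leftrightarrow(C(a,b)\vee C(a,c))$; $C(a,b)\Rightarrow C(b,a)$; $a\not\equiv0\Rightarrow C(a,a)$; 5. connectedness: $a\not\equiv 0\Rightarrow(a\not\equiv 1\Rightarrow C(a,-a))$. Let $T(\mathfrak F)$ be the set of theorems of $\mathfrak F$. **Strong-contact polytope algebras.** Let $n\ge 1$. A *basic polytope* in $\mathbb R^n$ is a set $\mathrm{Cl}(\mathrm{Int}(\bigcap F))$, where $F$ is a finite set of closed half-spaces $\{x:\langle a,x\rangle\le b\}$ ($a\ne 0$); a *polytope* is a finite union of basic polytopes. $PSC^n$ is the structure whose elements are the polytopes in $\mathbb R^n$, in which $-$ is interpreted as $A\mapsto \mathrm{Cl}(\mathbb R^n\setminus A)$, $+$ as union, $\equiv$ as equality, and $C(A,B)$ as *strong contact*: there is a connected open set $E\subseteq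 A\cup B$ with $E\cap A\neq\emptyset$ and $E\cap B\ne\emptyset$. A formula is *true in* $PSC^n$ if it is true under every assignment of polytopes to the variables; $L(\{PSC^n\})$ is the set of formulas true in $PSC^n$. **Theorem (Completeness).** For every integer $n\ge1$, every formula that is true in $PSC^n$ is a theorem of $\mathfrak F$. Moreover $L(\{PSC^n\})=T(\mathfrak F)$. -/

import Mathlib

namespace StrongContact

/-! ## The quantifier-free language of contact algebras -/

/-- Terms over the countable set `ℕ` of individual variables, built from the Boolean complement
and the Boolean join. -/
inductive Term : Type where
  | var : ℕ → Term
  | compl : Term → Term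
  | join : Term → Term → Term

namespace Term

/-- `a · b` abbreviates `-((-a) + (-b))`. -/
def meet (a b : Term) : Term := compl (join (compl a) (compl b))

/-- `0` abbreviates `p · (-p)`, for a fixed variable `p`. -/
def zero : Term := meet (var 0) (compl (var 0))

/-- `1` abbreviates `-0`. -/
def one : Term := compl zero

end Term

/-- Quantifier-free formulas: built by negation and disjunction from equations `a ≡ b` and contact
atoms `C(a, b)`. -/
inductive Formula : Type where
  | eq : Term → Term → Formula
  | contact : Term → Term → Formula
  | neg : Formula → Formula
  | disj : Formula → Formula → Formula

namespace Formula

/-- `φ ⇒ ψ` abbreviates `(¬φ) ∨ ψ`. -/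
def imp (φ ψ : Formula) : Formula := disj (neg φ) ψ

/-- `φ ∧ ψ` abbreviates `¬((¬φ) ∨ (¬ψ))`. -/
def conj (φ ψ : Formula) : Formula := neg (disj (neg φ) (neg ψ))

/-- `φ ⇔ ψ` abbreviates `(φ ⇒ ψ) ∧ (ψ ⇒ φ)`. -/
def iff (φ ψ : Formula) : Formula := conj (imp φ ψ) (imp ψ φ)

end Formula

/-! ## The formal system for connected contact algebras -/

open Term Formula in
/-- The axioms. -/
inductive IsAxiom : Formula → Prop where
  -- classical propositional logic
  | prop_k (φ ψ : Formula) : IsAxiom (imp φ (imp ψ φ))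
  | prop_s (φ ψ χ : Formula) :
      IsAxiom (imp (imp φ (imp ψ χ)) (imp (imp φ ψ) (imp φ χ)))
  | prop_contrapose (φ ψ : Formula) : IsAxiom (imp (imp (neg φ) (neg ψ)) (imp ψ φ))
  | prop_inl (φ ψ : Formula) : IsAxiom (imp φ (disj φ ψ))
  | prop_inr (φ ψ : Formula) : IsAxiom (imp ψ (disj φ ψ))
  | prop_cases (φ ψ χ : Formula) :
      IsAxiom (imp (imp φ χ) (imp (imp ψ χ) (imp (disj φ ψ) χ)))
  -- equality
  | eq_refl (a : Term) : IsAxiom (eq a a)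
  | eq_symm (a b : Term) : IsAxiom (imp (eq a b) (eq b a))
  | eq_trans (a b c : Term) : IsAxiom (imp (eq a b) (imp (eq b c) (eq a c)))
  | eq_compl (a b : Term) : IsAxiom (imp (eq a b) (eq (compl a) (compl b)))
  | eq_join (a b c d : Term) :
      IsAxiom (imp (eq a b) (imp (eq c d) (eq (join a c) (join b d))))
  | eq_contact (a b c d : Term) :
      IsAxiom (imp (eq a b) (imp (eq c d) (imp (contact a c) (contact b d))))
  -- Boolean algebras (with distinct zero and unit)
  | join_assoc (a b c : Term) : IsAxiom (eq (join a (join b c)) (join (join a b) c))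
  | meet_assoc (a b c : Term) : IsAxiom (eq (meet a (meet b c)) (meet (meet a b) c))
  | join_comm (a b : Term) : IsAxiom (eq (join a b) (join b a))
  | meet_comm (a b : Term) : IsAxiom (eq (meet a b) (meet b a))
  | join_absorb (a b : Term) : IsAxiom (eq (join a (meet a b)) a)
  | meet_absorb (a b : Term) : IsAxiom (eq (meet a (join a b)) a)
  | meet_distrib (a b c : Term) :
      IsAxiom (eq (meet a (join b c)) (join (meet a b) (meet a c)))
  | join_distrib (a b c : Term) :
      IsAxiom (eq (join a (meet b c)) (meet (join a b) (join a c)))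
  | join_compl (a : Term) : IsAxiom (eq (join a (compl a)) one)
  | meet_compl (a : Term) : IsAxiom (eq (meet a (compl a)) zero)
  | zero_ne_one : IsAxiom (neg (eq zero one))
  -- contact relations
  | contact_zero (a : Term) : IsAxiom (neg (contact zero a))
  | contact_join (a b c : Term) :
      IsAxiom (iff (contact a (join b c)) (disj (contact a b) (contact a c)))
  | contact_symm (a b : Term) : IsAxiom (imp (contact a b) (contact b a))
  | contact_self (a : Term) : IsAxiom (imp (neg (eq a zero)) (contact a a))
  -- connectedness
  | connected (a : Term) :
      IsAxiom (imp (neg (eq a zero)) (imp (neg (eq a one)) (contact a (compl a))))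

/-- The theorems of the system: modus ponens is the only rule of inference. -/
inductive IsTheorem : Formula → Prop where
  | ax {φ : Formula} : IsAxiom φ → IsTheorem φ
  | mp {φ ψ : Formula} : IsTheorem φ → IsTheorem (Formula.imp φ ψ) → IsTheorem ψ

/-! ## Semantics -/

/-- A structure for the language. -/
structure LStructure where
  carrier : Type
  nonempty : Nonempty carrier
  compl : carrier → carrier
  join : carrier → carrier → carrier
  contact : carrier → carrier → Prop

/-- The value of a term under a valuation of the variables. -/
def Term.val (S : LStructure) (v : ℕ → S.carrier) : Term → S.carrier
  | .var i => v i
  | .compl a => S.compl (a.val S v)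
  | .join a b => S.join (a.val S v) (b.val S v)

/-- Truth of a formula under a valuation; `≡` is interpreted as equality. -/
def Formula.TrueUnder (S : LStructure) (v : ℕ → S.carrier) : Formula → Prop
  | .eq a b => a.val S v = b.val S v
  | .contact a b => S.contact (a.val S v) (b.val S v)
  | .neg φ => ¬ φ.TrueUnder S v
  | .disj φ ψ => φ.TrueUnder S v ∨ ψ.TrueUnder S v

/-- A formula is true in a structure if it is true under every valuation. -/
def Formula.TrueIn (S : LStructure) (φ : Formula) : Prop :=
  ∀ v : ℕ → S.carrier, φ.TrueUnder S v

/-- The universal fragment of the logic of a structure: all formulas that are true in it. -/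
def universalFragment (S : LStructure) : Set Formula := {φ | φ.TrueIn S}

/-- The set of theorems of the formal system. -/
def theorems : Set Formula := {φ | IsTheorem φ}

/-! ## Strong contact and polytopes -/

/-- Strong contact of two subsets of a topological space. -/
def SC {X : Type*} [TopologicalSpace X] (A B : Set X) : Prop :=
  ∃ E : Set X, IsOpen E ∧ IsConnected E ∧ E ⊆ A ∪ B ∧ (E ∩ A).Nonempty ∧ (E ∩ B).Nonempty

/-- The regular closed set `Cl (Int A)` attached to `A`. -/
def reg {X : Type*} [TopologicalSpace X] (A : Set X) : Set X := closure (interior A)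

/-- The complement `A* = Cl (X \ A)` in the algebra of regular closed sets. -/
def regCompl {X : Type*} [TopologicalSpace X] (A : Set X) : Set X := closure Aᶜ

/-- Closed half-spaces of `ℝⁿ`. -/
def IsHalfSpace {n : ℕ} (H : Set (EuclideanSpace ℝ (Fin n))) : Prop :=
  ∃ (a : EuclideanSpace ℝ (Fin n)) (b : ℝ), a ≠ 0 ∧ H = {x | inner ℝ a x ≤ b}

/-- Basic polytopes: regularised intersections of finitely many closed half-spaces. -/
def IsBasicPolytope {n : ℕ} (A : Set (EuclideanSpace ℝ (Fin n))) : Prop :=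
  ∃ F : Set (Set (EuclideanSpace ℝ (Fin n))),
    F.Finite ∧ (∀ H ∈ F, IsHalfSpace H) ∧ A = reg (⋂₀ F)

/-- Polytopes: finite unions of basic polytopes. -/
def IsPolytope {n : ℕ} (A : Set (EuclideanSpace ℝ (Fin n))) : Prop :=
  ∃ F : Set (Set (EuclideanSpace ℝ (Fin n))),
    F.Finite ∧ (∀ B ∈ F, IsBasicPolytope B) ∧ A = ⋃₀ F

/-! ### Polytopes are closed under join and complement -/

section Topology

variable {X : Type*} [TopologicalSpace X]

theorem reg_union {A B : Set X} (hA : IsClosed A) : reg (A ∪ B) = reg A ∪ reg B := by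
  apply subset_antisymm
  · unfold reg
    rw [← closure_union]
    apply closure_minimal _ isClosed_closure
    intro p hp
    rw [mem_closure_iff]
    intro V hV hpV
    have hW : IsOpen (V ∩ interior (A ∪ B)) := hV.inter isOpen_interior
    by_cases h : V ∩ interior (A ∪ B) ⊆ A
    · exact ⟨p, hpV, Or.inl (interior_maximal h hW ⟨hpV, hp⟩)⟩
    · obtain ⟨q, hq, hqA⟩ := Set.not_subset.1 h
      refine ⟨q, hq.1, Or.inr ?_⟩
      refine interior_maximal (s := B) (t := (V ∩ interior (A ∪ B)) ∩ Aᶜ) ?_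
        (hW.inter hA.isOpen_compl) ⟨hq, hqA⟩
      rintro r ⟨⟨_, hr⟩, hrA⟩
      exact (interior_subset hr).resolve_left hrA
  · exact Set.union_subset (closure_mono (interior_mono Set.subset_union_left))
      (closure_mono (interior_mono Set.subset_union_right))

theorem interior_reg {A : Set X} (hA : IsClosed A) : interior (reg A) = interior A := by
  apply subset_antisymm
  · exact interior_mono (closure_minimal interior_subset hA)
  · exact interior_maximal subset_closure isOpen_interior

theorem reg_inter_reg {A B : Set X} (hA : IsClosed A) (hB : IsClosed B) :
    reg (reg A ∩ reg B) = reg (A ∩ B) := by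
  conv_lhs => rw [reg, interior_inter, interior_reg hA, interior_reg hB]
  rw [reg, interior_inter]

theorem star_reg {A : Set X} (hA : IsClosed A) : regCompl (reg A) = regCompl A := by
  rw [regCompl, regCompl, closure_compl, closure_compl, interior_reg hA]

theorem reg_star {A : Set X} (hA : IsClosed A) : reg (regCompl A) = regCompl A :=
  subset_antisymm (closure_minimal interior_subset isClosed_closure)
    (closure_mono (interior_maximal subset_closure hA.isOpen_compl))

theorem star_inter (A B : Set X) : regCompl (A ∩ B) = regCompl A ∪ regCompl B := by
  rw [regCompl, regCompl, regCompl, Set.compl_inter, closure_union]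

theorem star_union {A B : Set X} (hA : reg A = A) (hB : reg B = B) :
    regCompl (A ∪ B) = reg (regCompl A ∩ regCompl B) := by
  have h : ∀ C : Set X, reg C = C → interior (regCompl C) = Cᶜ := by
    intro C hC
    conv_rhs => rw [← hC, reg, ← interior_compl, ← closure_compl]
    rfl
  rw [reg, interior_inter, h A hA, h B hB, regCompl, Set.compl_union]

end Topology

section Polytopes

variable {n : ℕ}

theorem IsHalfSpace.isClosed {H : Set (EuclideanSpace ℝ (Fin n))} (h : IsHalfSpace H) :
    IsClosed H := by
  obtain ⟨a, b, _, rfl⟩ := h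
  exact isClosed_le (by fun_prop) continuous_const

theorem star_halfSpace {a : EuclideanSpace ℝ (Fin n)} (ha : a ≠ 0) (b : ℝ) :
    regCompl {x : EuclideanSpace ℝ (Fin n) | inner ℝ a x ≤ b} = {x | inner ℝ (-a) x ≤ -b} := by
  have hs : Function.Surjective (innerSL ℝ a) := by
    intro t
    refine ⟨(t / inner ℝ a a) • a, ?_⟩
    have : inner ℝ a a ≠ 0 := inner_self_ne_zero.2 ha
    rw [innerSL_apply_apply, inner_smul_right, div_mul_cancel₀ _ this]
  have ho : IsOpenMap (innerSL ℝ a) := (innerSL ℝ a).isOpenMap hs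
  have hc := ho.preimage_closure_eq_closure_preimage (innerSL ℝ a).continuous (Set.Ioi b)
  rw [closure_Ioi] at hc
  have e : ({x | inner ℝ a x ≤ b} : Set (EuclideanSpace ℝ (Fin n)))ᶜ
      = (innerSL ℝ a) ⁻¹' Set.Ioi b := by
    ext x; simp
  rw [regCompl, e, ← hc]
  ext x; simp

theorem IsHalfSpace.star_star {H : Set (EuclideanSpace ℝ (Fin n))} (h : IsHalfSpace H) :
    IsHalfSpace (regCompl H) ∧ regCompl (regCompl H) = H := by
  obtain ⟨a, b, ha, rfl⟩ := h
  refine ⟨⟨-a, -b, neg_ne_zero.2 ha, star_halfSpace ha b⟩, ?_⟩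
  rw [star_halfSpace ha, star_halfSpace (neg_ne_zero.2 ha), neg_neg, neg_neg]

theorem isClosed_sInter_halfSpaces {F : Set (Set (EuclideanSpace ℝ (Fin n)))}
    (hF : ∀ H ∈ F, IsHalfSpace H) : IsClosed (⋂₀ F) :=
  isClosed_sInter fun H hH => (hF H hH).isClosed

theorem IsBasicPolytope.inter {A B : Set (EuclideanSpace ℝ (Fin n))}
    (hA : IsBasicPolytope A) (hB : IsBasicPolytope B) : IsBasicPolytope (reg (A ∩ B)) := by
  obtain ⟨F, hF, hF', rfl⟩ := hA
  obtain ⟨G, hG, hG', rfl⟩ := hB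
  refine ⟨F ∪ G, hF.union hG, ?_, ?_⟩
  · rintro H (h | h)
    exacts [hF' H h, hG' H h]
  · rw [reg_inter_reg (isClosed_sInter_halfSpaces hF') (isClosed_sInter_halfSpaces hG'),
      Set.sInter_union]

theorem IsBasicPolytope.isPolytope {A : Set (EuclideanSpace ℝ (Fin n))}
    (hA : IsBasicPolytope A) : IsPolytope A :=
  ⟨{A}, Set.finite_singleton A, by rintro B rfl; exact hA, by simp⟩

theorem isPolytope_empty : IsPolytope (∅ : Set (EuclideanSpace ℝ (Fin n))) :=
  ⟨∅, Set.finite_empty, by simp, by simp⟩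

theorem isPolytope_univ : IsPolytope (Set.univ : Set (EuclideanSpace ℝ (Fin n))) :=
  IsBasicPolytope.isPolytope ⟨∅, Set.finite_empty, by simp, by simp [reg]⟩

theorem IsPolytope.union {A B : Set (EuclideanSpace ℝ (Fin n))}
    (hA : IsPolytope A) (hB : IsPolytope B) : IsPolytope (A ∪ B) := by
  obtain ⟨F, hF, hF', rfl⟩ := hA
  obtain ⟨G, hG, hG', rfl⟩ := hB
  refine ⟨F ∪ G, hF.union hG, ?_, by rw [Set.sUnion_union]⟩
  rintro H (h | h)
  exacts [hF' H h, hG' H h]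

theorem IsPolytope.induction {P : Set (EuclideanSpace ℝ (Fin n)) → Prop}
    (h0 : P ∅) (h1 : ∀ A B, IsBasicPolytope A → IsPolytope B → P B → P (A ∪ B))
    {A : Set (EuclideanSpace ℝ (Fin n))} (hA : IsPolytope A) : P A := by
  obtain ⟨F, hF, hF', rfl⟩ := hA
  induction F, hF using Set.Finite.induction_on with
  | empty => simpa using h0
  | @insert a s _ hs ih =>
    rw [Set.sUnion_insert]
    have hs' : ∀ B ∈ s, IsBasicPolytope B := fun B hB => hF' B (Set.mem_insert_of_mem _ hB)
    exact h1 _ _ (hF' a (Set.mem_insert _ _)) ⟨s, hs, hs', rfl⟩ (ih hs')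

theorem IsBasicPolytope.isClosed {A : Set (EuclideanSpace ℝ (Fin n))}
    (hA : IsBasicPolytope A) : IsClosed A := by
  obtain ⟨F, _, _, rfl⟩ := hA
  exact isClosed_closure

theorem IsPolytope.isClosed {A : Set (EuclideanSpace ℝ (Fin n))}
    (hA : IsPolytope A) : IsClosed A := by
  obtain ⟨F, hF, hF', rfl⟩ := hA
  rw [Set.sUnion_eq_biUnion]
  exact hF.isClosed_biUnion fun B hB => (hF' B hB).isClosed

theorem IsBasicPolytope.reg_eq {A : Set (EuclideanSpace ℝ (Fin n))}
    (hA : IsBasicPolytope A) : reg A = A := by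
  obtain ⟨F, _, hF', rfl⟩ := hA
  conv_lhs => rw [reg, interior_reg (isClosed_sInter_halfSpaces hF')]
  rfl

/-- Polytopes are regular closed. -/
theorem IsPolytope.reg_eq {A : Set (EuclideanSpace ℝ (Fin n))}
    (hA : IsPolytope A) : reg A = A := by
  refine IsPolytope.induction (P := fun A => reg A = A) (by simp [reg]) ?_ hA
  intro A B hA hB ih
  rw [reg_union hA.isClosed, hA.reg_eq, ih]

theorem IsPolytope.inter {A B : Set (EuclideanSpace ℝ (Fin n))}
    (hA : IsPolytope A) (hB : IsPolytope B) : IsPolytope (reg (A ∩ B)) := by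
  refine IsPolytope.induction (P := fun A => IsPolytope (reg (A ∩ B)))
    (by simpa [reg] using isPolytope_empty) ?_ hA
  intro A A' hA hA' ih
  rw [Set.union_inter_distrib_right, reg_union (hA.isClosed.inter hB.isClosed)]
  refine IsPolytope.union ?_ ih
  refine IsPolytope.induction (P := fun B => IsPolytope (reg (A ∩ B)))
    (by simpa [reg] using isPolytope_empty) ?_ hB
  intro B B' hB hB' ih
  rw [Set.inter_union_distrib_left, reg_union (hA.isClosed.inter hB.isClosed)]
  exact IsPolytope.union (hA.inter hB).isPolytope ih

theorem IsHalfSpace.isPolytope {H : Set (EuclideanSpace ℝ (Fin n))} (h : IsHalfSpace H) :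
    IsPolytope H := by
  have hr : reg H = H := by
    conv_rhs => rw [← h.star_star.2]
    conv_lhs => rw [← h.star_star.2]
    exact reg_star h.star_star.1.isClosed
  refine IsBasicPolytope.isPolytope ⟨{H}, Set.finite_singleton H, ?_, by simp [hr]⟩
  rintro B rfl
  exact h

theorem isPolytope_star_sInter {F : Set (Set (EuclideanSpace ℝ (Fin n)))} (hF : F.Finite)
    (hF' : ∀ H ∈ F, IsHalfSpace H) : IsPolytope (regCompl (⋂₀ F)) := by
  induction F, hF using Set.Finite.induction_on with
  | empty => simpa [regCompl] using isPolytope_empty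
  | @insert a s _ _ ih =>
    rw [Set.sInter_insert, star_inter]
    exact (hF' a (Set.mem_insert _ _)).star_star.1.isPolytope.union
      (ih fun H hH => hF' H (Set.mem_insert_of_mem _ hH))

/-- Polytopes are closed under the complement of the algebra of regular closed sets. -/
theorem IsPolytope.regCompl {A : Set (EuclideanSpace ℝ (Fin n))}
    (hA : IsPolytope A) : IsPolytope (regCompl A) := by
  refine IsPolytope.induction (P := fun A => IsPolytope (StrongContact.regCompl A))
    (by simpa [StrongContact.regCompl] using isPolytope_univ) ?_ hA
  intro A B hA hB ih
  rw [star_union hA.reg_eq hB.reg_eq]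
  refine IsPolytope.inter ?_ ih
  obtain ⟨F, hF, hF', rfl⟩ := hA
  rw [star_reg (isClosed_sInter_halfSpaces hF')]
  exact isPolytope_star_sInter hF hF'

end Polytopes

/-- The strong-contact algebra of polytopes in `ℝⁿ`. -/
def PSC (n : ℕ) : LStructure where
  carrier := {A : Set (EuclideanSpace ℝ (Fin n)) // IsPolytope A}
  nonempty := ⟨⟨∅, isPolytope_empty⟩⟩
  compl A := ⟨regCompl A.1, A.2.regCompl⟩
  join A B := ⟨A.1 ∪ B.1, A.2.union B.2⟩
  contact A B := SC A.1 B.1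

end StrongContact

/-!
Soundness. A polytope is determined by its interior, and `A ↦ interior A` turns complement and union
into the operations of the Boolean algebra of regular open sets, which gives the Boolean axioms. The
one geometric axiom is `SC_union_right`: strong contact with a union is strong contact with one of
its parts. A connected open set inside `A ∪ (B ∪ C)` that meets both sides contains a point common
to both, and a small ball around that point meets both interiors. A segment in general position
between the interiors crosses the finitely many hyperplanes that carry the frontiers one at a time
(`exists_mem_inter_generic`), so it passes from `A` to `B` or `C` at a point near which a single
hyperplane matters, and there the two sets are in strong contact (`SC_of_mem_inter`).

Completeness. If `φ` is not a theorem, Lindenbaum's lemma gives a maximal theory omitting `φ`, and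
the terms modulo its equations form a Boolean algebra with a connected contact relation. Only the
nonzero minterms in the variables of `φ` matter for the truth of `φ` (`mem_iff_holdsIn`): they are
the vertices of a finite graph whose edges are the contacts. The graph is reflexive and symmetric by
the contact axioms and connected by the connectedness axiom (`reflTransGen_minterm`), so some walk
traverses all its edges. Cut `ℝⁿ` by parallel hyperplanes into one slab for each position on the
walk and give each vertex the union of the slabs at which the walk visits it. Two slabs are in strong
contact exactly when they are equal or neighbours (`SC_cells`), hence two vertices are in strong
contact exactly when they are joined by an edge, and `φ` fails in `PSC n` as it does in the graph
(`trueUnder_walkValuation`). One coordinate direction suffices, so all dimensions `n ≥ 1` are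
treated alike.
-/

namespace StrongContact

/-! ### The Boolean laws for polytopes -/

section BooleanLaws

open TopologicalSpace

variable {n : ℕ}

/-- The Boolean algebra of regular open sets of `ℝⁿ`. -/
def RegOpen (n : ℕ) : Type := Heyting.Regular (Opens (EuclideanSpace ℝ (Fin n)))

instance : BooleanAlgebra (RegOpen n) :=
  inferInstanceAs (BooleanAlgebra (Heyting.Regular (Opens (EuclideanSpace ℝ (Fin n)))))

/-- The regular open set underlying an element of `RegOpen n`. -/
def RegOpen.toSet (U : RegOpen n) : Set (EuclideanSpace ℝ (Fin n)) :=
  (Heyting.Regular.val U : Opens (EuclideanSpace ℝ (Fin n)))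

theorem RegOpen.toSet_injective : Function.Injective (RegOpen.toSet (n := n)) := fun _ _ h =>
  Heyting.Regular.coe_injective (SetLike.coe_injective h)

theorem RegOpen.toSet_compl (U : RegOpen n) : Uᶜ.toSet = interior U.toSetᶜ :=
  Opens.coe_compl_eq_interior_compl

theorem RegOpen.toSet_sup (U V : RegOpen n) :
    (U ⊔ V).toSet = interior (closure (U.toSet ∪ V.toSet)) := by
  change (((Heyting.Regular.val U ⊔ Heyting.Regular.val V)ᶜᶜ :
    Opens (EuclideanSpace ℝ (Fin n))) : Set (EuclideanSpace ℝ (Fin n))) = _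
  rw [Opens.coe_compl_eq_interior_compl, Opens.coe_compl_eq_interior_compl, interior_compl,
    interior_compl, closure_compl, compl_compl]
  rfl

theorem RegOpen.toSet_bot : (⊥ : RegOpen n).toSet = ∅ := rfl

theorem RegOpen.toSet_top : (⊤ : RegOpen n).toSet = Set.univ := rfl

/-- The regularised interior of a set, as a regular open set. -/
def regInt (A : Set (EuclideanSpace ℝ (Fin n))) : RegOpen n :=
  Heyting.Regular.toRegular (Opens.interior A)

theorem toSet_regInt {A : Set (EuclideanSpace ℝ (Fin n))} (hA : reg A = A) :
    (regInt A).toSet = interior A := by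
  change (((Opens.interior A)ᶜᶜ : Opens _) : Set (EuclideanSpace ℝ (Fin n))) = _
  rw [Opens.coe_compl_eq_interior_compl, Opens.coe_compl_eq_interior_compl, Opens.coe_interior,
    interior_compl, interior_compl, closure_compl, compl_compl]
  exact congrArg interior hA

theorem reg_toSet_regInt {A : Set (EuclideanSpace ℝ (Fin n))} (hA : reg A = A) :
    closure (regInt A).toSet = A := by
  rw [toSet_regInt hA]
  exact hA

/-- The value of a term in `PSC n`, as a polytope. -/
def value (v : ℕ → (PSC n).carrier) (a : Term) :
    {A : Set (EuclideanSpace ℝ (Fin n)) // IsPolytope A} :=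
  a.val (PSC n) v

theorem coe_value_compl (v : ℕ → (PSC n).carrier) (a : Term) :
    (value v a.compl).1 = regCompl (value v a).1 := rfl

theorem coe_value_join (v : ℕ → (PSC n).carrier) (a b : Term) :
    (value v (a.join b)).1 = (value v a).1 ∪ (value v b).1 := rfl

theorem value_ext {v : ℕ → (PSC n).carrier} {a b : Term}
    (h : regInt (value v a).1 = regInt (value v b).1) : a.val (PSC n) v = b.val (PSC n) v := by
  refine Subtype.ext (a1 := value v a) (a2 := value v b) ?_
  rw [← reg_toSet_regInt (value v a).2.reg_eq, h, reg_toSet_regInt (value v b).2.reg_eq]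

theorem regInt_value_compl (v : ℕ → (PSC n).carrier) (a : Term) :
    regInt (value v a.compl).1 = (regInt (value v a).1)ᶜ := by
  apply RegOpen.toSet_injective
  rw [toSet_regInt (value v a.compl).2.reg_eq, RegOpen.toSet_compl,
    toSet_regInt (value v a).2.reg_eq, ← closure_compl, coe_value_compl]
  rfl

theorem regInt_value_join (v : ℕ → (PSC n).carrier) (a b : Term) :
    regInt (value v (a.join b)).1 = regInt (value v a).1 ⊔ regInt (value v b).1 := by
  apply RegOpen.toSet_injective
  rw [toSet_regInt (value v (a.join b)).2.reg_eq, RegOpen.toSet_sup, closure_union,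
    reg_toSet_regInt (value v a).2.reg_eq, reg_toSet_regInt (value v b).2.reg_eq, coe_value_join]

theorem regInt_value_meet (v : ℕ → (PSC n).carrier) (a b : Term) :
    regInt (value v (a.meet b)).1 = regInt (value v a).1 ⊓ regInt (value v b).1 := by
  simp only [Term.meet, regInt_value_join, regInt_value_compl, compl_sup, compl_compl]

theorem regInt_value_zero (v : ℕ → (PSC n).carrier) : regInt (value v Term.zero).1 = ⊥ := by
  simp only [Term.zero, regInt_value_meet, regInt_value_compl, inf_compl_eq_bot]

theorem regInt_value_one (v : ℕ → (PSC n).carrier) : regInt (value v Term.one).1 = ⊤ := by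
  simp only [Term.one, regInt_value_zero, regInt_value_compl, compl_bot]

theorem coe_value_zero (v : ℕ → (PSC n).carrier) : (value v Term.zero).1 = ∅ := by
  rw [← reg_toSet_regInt (value v Term.zero).2.reg_eq, regInt_value_zero, RegOpen.toSet_bot,
    closure_empty]

theorem coe_value_one (v : ℕ → (PSC n).carrier) : (value v Term.one).1 = Set.univ := by
  rw [← reg_toSet_regInt (value v Term.one).2.reg_eq, regInt_value_one, RegOpen.toSet_top,
    closure_univ]

end BooleanLaws

/-! ### Distributivity of strong contact over unions of polytopes -/

section Distributivity

variable {X : Type*} [TopologicalSpace X]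

theorem SC.symm {A B : Set X} : SC A B → SC B A := by
  rintro ⟨E, ho, hc, hE, hA, hB⟩
  exact ⟨E, ho, hc, by rwa [Set.union_comm], hB, hA⟩

theorem SC.mono_right {A B C : Set X} (hBC : B ⊆ C) : SC A B → SC A C := by
  rintro ⟨E, ho, hc, hE, hA, hB⟩
  exact ⟨E, ho, hc, hE.trans (Set.union_subset_union_right _ hBC), hA,
    hB.mono (Set.inter_subset_inter_right _ hBC)⟩

theorem subset_of_disjoint_frontier {S A : Set X} (hS : IsPreconnected S)
    (hd : Disjoint S (frontier A)) (hne : (S ∩ A).Nonempty) : S ⊆ A := by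
  have hin : ∀ x ∈ S, x ∈ closure A → x ∈ interior A := fun x hx hxA => by
    by_contra h
    exact Set.disjoint_left.1 hd hx ⟨hxA, h⟩
  obtain ⟨x, hxS, hxA⟩ := hne
  exact (hS.subset_of_closure_inter_subset isOpen_interior
    ⟨x, hxS, hin x hxS (subset_closure hxA)⟩
    fun y hy => hin y hy.2 (closure_mono interior_subset hy.1)).trans interior_subset

variable {n : ℕ}

/-- The frontier of a polytope lies in a finite union of hyperplanes `⟪a, x⟫ = b`, listed here as
pairs `(a, b)`. -/
theorem IsPolytope.exists_frontier_subset {A : Set (EuclideanSpace ℝ (Fin n))}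
    (hA : IsPolytope A) :
    ∃ P : Finset (EuclideanSpace ℝ (Fin n) × ℝ), (∀ p ∈ P, p.1 ≠ 0) ∧
      ∀ x ∈ frontier A, ∃ p ∈ P, inner ℝ p.1 x - p.2 = 0 := by
  classical
  refine IsPolytope.induction (P := fun A => ∃ P : Finset (EuclideanSpace ℝ (Fin n) × ℝ),
    (∀ p ∈ P, p.1 ≠ 0) ∧ ∀ x ∈ frontier A, ∃ p ∈ P, inner ℝ p.1 x - p.2 = 0)
    ⟨∅, by simp, by simp⟩ ?_ hA
  rintro _ B ⟨F, hF, hF', rfl⟩ - ⟨Q, hQ, hQ'⟩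
  have key : ∃ P : Finset (EuclideanSpace ℝ (Fin n) × ℝ), (∀ p ∈ P, p.1 ≠ 0) ∧
      ∀ x ∈ frontier (⋂₀ F), ∃ p ∈ P, inner ℝ p.1 x - p.2 = 0 := by
    induction F, hF using Set.Finite.induction_on with
    | empty => exact ⟨∅, by simp, by simp⟩
    | @insert H s _ _ ih =>
      obtain ⟨P, hP, hP'⟩ := ih fun K hK => hF' K (Set.mem_insert_of_mem _ hK)
      obtain ⟨a, b, ha, rfl⟩ := hF' H (Set.mem_insert _ _)
      refine ⟨insert (a, b) P, ?_, fun x hx => ?_⟩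
      · intro p hp
        rcases Finset.mem_insert.1 hp with rfl | hp
        exacts [ha, hP p hp]
      · rw [Set.sInter_insert] at hx
        rcases frontier_inter_subset _ _ hx with h | h
        · have := frontier_le_subset_eq (by fun_prop) continuous_const h.1
          exact ⟨(a, b), Finset.mem_insert_self _ _, sub_eq_zero.2 this⟩
        · obtain ⟨p, hp, hpx⟩ := hP' x h.2
          exact ⟨p, Finset.mem_insert_of_mem hp, hpx⟩
  obtain ⟨P, hP, hP'⟩ := key
  refine ⟨P ∪ Q, ?_, fun x hx => ?_⟩
  · intro p hp
    rcases Finset.mem_union.1 hp with h | h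
    exacts [hP p h, hQ p h]
  · rcases frontier_union_subset _ _ hx with h | h
    · obtain ⟨p, hp, hpx⟩ := hP' x (frontier_interior_subset (frontier_closure_subset h.1))
      exact ⟨p, Finset.mem_union_left _ hp, hpx⟩
    · obtain ⟨p, hp, hpx⟩ := hQ' x h.2
      exact ⟨p, Finset.mem_union_right _ hp, hpx⟩

/-- An affine function that is not identically zero is nonzero on a dense open set. -/
theorem dense_affine_ne_zero (a : EuclideanSpace ℝ (Fin n)) (b : ℝ) (h : a ≠ 0 ∨ b ≠ 0) :
    Dense {x : EuclideanSpace ℝ (Fin n) | inner ℝ a x - b ≠ 0} := by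
  by_cases ha : a = 0
  · have hb : b ≠ 0 := h.resolve_left (not_not.2 ha)
    simp [ha, hb]
  · intro x
    have hpos : (0 : ℝ) < inner ℝ a a := real_inner_self_pos.2 ha
    by_cases hx : inner ℝ a x - b = 0
    · -- move off the hyperplane along its normal vector
      have ht : Filter.Tendsto (fun t : ℝ => x + t • a) (nhdsWithin 0 {0}ᶜ) (nhds x) := by
        have : Continuous fun t : ℝ => x + t • a := by fun_prop
        simpa using (this.tendsto 0).mono_left nhdsWithin_le_nhds
      refine mem_closure_of_tendsto ht ?_
      filter_upwards [self_mem_nhdsWithin] with t ht0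
      have : inner ℝ a (x + t • a) - b = t * inner ℝ a a := by
        rw [inner_add_right, inner_smul_right]
        linarith
      change inner ℝ a (x + t • a) - b ≠ 0
      rw [this]
      exact mul_ne_zero ht0 hpos.ne'
    · exact subset_closure hx

theorem isOpen_affine_ne_zero (a : EuclideanSpace ℝ (Fin n)) (b : ℝ) :
    IsOpen {x : EuclideanSpace ℝ (Fin n) | inner ℝ a x - b ≠ 0} :=
  isOpen_ne_fun (by fun_prop) continuous_const

/-- Regular closed sets with a common point `z` are in strong contact if, near `z`, their frontiers
lie in a single hyperplane: each of them contains one of the two open sides of the hyperplane. -/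
theorem SC_of_mem_inter {A B V : Set (EuclideanSpace ℝ (Fin n))} (hA : reg A = A)
    (hB : reg B = B) (hV : IsOpen V) (hVc : Convex ℝ V) {z : EuclideanSpace ℝ (Fin n)}
    (hz : z ∈ V) (hzA : z ∈ A) (hzB : z ∈ B) {a : EuclideanSpace ℝ (Fin n)} {b : ℝ} (ha : a ≠ 0)
    (hfA : ∀ x ∈ V, x ∈ frontier A → inner ℝ a x - b = 0)
    (hfB : ∀ x ∈ V, x ∈ frontier B → inner ℝ a x - b = 0) : SC A B := by
  have hcont : Continuous fun x : EuclideanSpace ℝ (Fin n) => inner ℝ a x - b := by fun_prop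
  have hpo : IsOpen (V ∩ {x | 0 < inner ℝ a x - b}) :=
    hV.inter (isOpen_lt continuous_const hcont)
  have hno : IsOpen (V ∩ {x | inner ℝ a x - b < 0}) :=
    hV.inter (isOpen_lt hcont continuous_const)
  have hpc : Convex ℝ (V ∩ {x | 0 < inner ℝ a x - b}) := by
    refine hVc.inter ?_
    have := convex_halfSpace_gt (innerSL ℝ a).toLinearMap.isLinear b
    simpa [sub_pos] using this
  have hnc : Convex ℝ (V ∩ {x | inner ℝ a x - b < 0}) := by
    refine hVc.inter ?_
    have := convex_halfSpace_lt (innerSL ℝ a).toLinearMap.isLinear b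
    simpa [sub_neg] using this
  have side : ∀ C : Set (EuclideanSpace ℝ (Fin n)), reg C = C → z ∈ C →
      (∀ x ∈ V, x ∈ frontier C → inner ℝ a x - b = 0) →
      ((V ∩ {x | 0 < inner ℝ a x - b}).Nonempty ∧ V ∩ {x | 0 < inner ℝ a x - b} ⊆ C) ∨
      ((V ∩ {x | inner ℝ a x - b < 0}).Nonempty ∧ V ∩ {x | inner ℝ a x - b < 0} ⊆ C) := by
    intro C hC hzC hfC
    have h1 : (V ∩ interior C).Nonempty := mem_closure_iff.1 (by rwa [← hC] at hzC) V hV hz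
    obtain ⟨w, ⟨hwV, hwC⟩, hw⟩ :=
      (dense_affine_ne_zero a b (Or.inl ha)).inter_open_nonempty _ (hV.inter isOpen_interior) h1
    rcases lt_or_gt_of_ne hw with hlt | hgt
    · refine Or.inr ⟨⟨w, hwV, hlt⟩, subset_of_disjoint_frontier hnc.isPreconnected ?_
        ⟨w, ⟨hwV, hlt⟩, interior_subset hwC⟩⟩
      exact Set.disjoint_left.2 fun x hx hxf => hx.2.ne (hfC x hx.1 hxf)
    · refine Or.inl ⟨⟨w, hwV, hgt⟩, subset_of_disjoint_frontier hpc.isPreconnected ?_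
        ⟨w, ⟨hwV, hgt⟩, interior_subset hwC⟩⟩
      exact Set.disjoint_left.2 fun x hx hxf => hx.2.ne' (hfC x hx.1 hxf)
  have both : V ∩ {x | inner ℝ a x - b ≠ 0} ⊆ A ∪ B → SC A B := by
    intro h
    have hcl : IsClosed (A ∪ B) := by
      rw [← hA, ← hB]
      exact isClosed_closure.union isClosed_closure
    refine ⟨V, hV, ⟨⟨z, hz⟩, hVc.isPreconnected⟩, ?_, ⟨z, hz, hzA⟩, ⟨z, hz, hzB⟩⟩
    exact ((dense_affine_ne_zero a b (Or.inl ha)).open_subset_closure_inter hV).trans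
      (closure_minimal h hcl)
  rcases side A hA hzA hfA with ⟨hne, hsA⟩ | ⟨hne, hsA⟩ <;>
    rcases side B hB hzB hfB with ⟨_, hsB⟩ | ⟨_, hsB⟩
  · obtain ⟨w, hw⟩ := hne
    exact ⟨_, hpo, ⟨⟨w, hw⟩, hpc.isPreconnected⟩, hsA.trans Set.subset_union_left,
      ⟨w, hw, hsA hw⟩, ⟨w, hw, hsB hw⟩⟩
  · refine both fun x hx => ?_
    rcases lt_or_gt_of_ne hx.2 with h | h
    exacts [Or.inr (hsB ⟨hx.1, h⟩), Or.inl (hsA ⟨hx.1, h⟩)]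
  · refine both fun x hx => ?_
    rcases lt_or_gt_of_ne hx.2 with h | h
    exacts [Or.inl (hsA ⟨hx.1, h⟩), Or.inr (hsB ⟨hx.1, h⟩)]
  · obtain ⟨w, hw⟩ := hne
    exact ⟨_, hno, ⟨⟨w, hw⟩, hnc.isPreconnected⟩, hsA.trans Set.subset_union_left,
      ⟨w, hw, hsA hw⟩, ⟨w, hw, hsB hw⟩⟩

/-- Inside a convex open set meeting the interiors of two closed sets that cover it, some point of
both sets lies on at most one hyperplane of a given finite family. It is found on a segment between
the two interiors in general position: for fixed `x` off all hyperplanes, the `y` such that the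
line through `x` and `y` meets two different hyperplanes in the same point satisfy one of finitely
many nontrivial affine equations. -/
theorem exists_mem_inter_generic (P : Finset (EuclideanSpace ℝ (Fin n) × ℝ))
    (hP : ∀ p ∈ P, p.1 ≠ 0) {U A D : Set (EuclideanSpace ℝ (Fin n))} (hU : IsOpen U)
    (hUc : Convex ℝ U) (hA : IsClosed A) (hD : IsClosed D) (hUAD : U ⊆ A ∪ D)
    (hUA : (U ∩ interior A).Nonempty) (hUD : (U ∩ interior D).Nonempty) :
    ∃ z ∈ U, z ∈ A ∧ z ∈ D ∧ ∀ p ∈ P, ∀ q ∈ P, inner ℝ p.1 z - p.2 = 0 →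
      inner ℝ q.1 z - q.2 = 0 → ∀ w, inner ℝ q.1 w - q.2 = 0 → inner ℝ p.1 w - p.2 = 0 := by
  have hd1 : Dense (⋂ p ∈ (P : Set (EuclideanSpace ℝ (Fin n) × ℝ)),
      {x : EuclideanSpace ℝ (Fin n) | inner ℝ p.1 x - p.2 ≠ 0}) :=
    dense_biInter_of_isOpen (fun p _ => isOpen_affine_ne_zero _ _) P.countable_toSet
      fun p hp => dense_affine_ne_zero _ _ (Or.inl (hP p hp))
  obtain ⟨x, ⟨hxU, hxA⟩, hx⟩ := hd1.inter_open_nonempty _ (hU.inter isOpen_interior) hUA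
  simp only [Set.mem_iInter, Finset.mem_coe, Set.mem_ofPred_eq] at hx
  -- the coefficients of `g r = f_p(x) f_q - f_q(x) f_p`, where `r = (p, q)`
  let c : (EuclideanSpace ℝ (Fin n) × ℝ) × (EuclideanSpace ℝ (Fin n) × ℝ) →
      EuclideanSpace ℝ (Fin n) × ℝ := fun r =>
    ((inner ℝ r.1.1 x - r.1.2) • r.2.1 - (inner ℝ r.2.1 x - r.2.2) • r.1.1,
      (inner ℝ r.1.1 x - r.1.2) * r.2.2 - (inner ℝ r.2.1 x - r.2.2) * r.1.2)
  have hc : ∀ p q y, inner ℝ (c (p, q)).1 y - (c (p, q)).2 =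
      (inner ℝ p.1 x - p.2) * (inner ℝ q.1 y - q.2) -
        (inner ℝ q.1 x - q.2) * (inner ℝ p.1 y - p.2) := by
    intro p q y
    simp only [c, inner_sub_left, real_inner_smul_left]
    ring
  have hd2 : Dense (⋂ r ∈ {r | r ∈ P ×ˢ P ∧ ((c r).1 ≠ 0 ∨ (c r).2 ≠ 0)},
      {y : EuclideanSpace ℝ (Fin n) | inner ℝ (c r).1 y - (c r).2 ≠ 0}) :=
    dense_biInter_of_isOpen (fun p _ => isOpen_affine_ne_zero _ _)
      (((P ×ˢ P).countable_toSet).mono fun r hr => hr.1)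
      fun r hr => dense_affine_ne_zero _ _ hr.2
  obtain ⟨y, ⟨hyU, hyD⟩, hy⟩ := hd2.inter_open_nonempty _ (hU.inter isOpen_interior) hUD
  simp only [Set.mem_iInter, Set.mem_ofPred_eq, Finset.mem_product] at hy
  have hseg : segment ℝ x y ⊆ U := hUc.segment_subset hxU hyU
  obtain ⟨z, hzs, hzA, hzD⟩ := isPreconnected_closed_iff.1
    (convex_segment (𝕜 := ℝ) x y).isPreconnected A D hA hD (hseg.trans hUAD)
    ⟨x, left_mem_segment ℝ x y, interior_subset hxA⟩
    ⟨y, right_mem_segment ℝ x y, interior_subset hyD⟩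
  refine ⟨z, hseg hzs, hzA, hzD, fun p hp q hq hpz hqz w hw => ?_⟩
  obtain ⟨s, t, -, -, hst, rfl⟩ := hzs
  have haff : ∀ p : EuclideanSpace ℝ (Fin n) × ℝ, inner ℝ p.1 (s • x + t • y) - p.2 =
      s * (inner ℝ p.1 x - p.2) + t * (inner ℝ p.1 y - p.2) := by
    intro p
    rw [inner_add_right, inner_smul_right, inner_smul_right]
    linear_combination p.2 * hst
  rw [haff] at hpz hqz
  have ht : t ≠ 0 := by
    rintro rfl
    have : s = 1 := by linarith
    rw [this] at hpz
    exact hx p hp (by linarith)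
  have hg : inner ℝ (c (p, q)).1 y - (c (p, q)).2 = 0 := by
    rw [hc]
    refine (mul_eq_zero.1 ?_).resolve_left ht
    linear_combination (inner ℝ p.1 x - p.2) * hqz - (inner ℝ q.1 x - q.2) * hpz
  have h0 : (c (p, q)).1 = 0 ∧ (c (p, q)).2 = 0 := by
    by_contra h
    exact hy (p, q) ⟨⟨hp, hq⟩, not_and_or.1 h⟩ hg
  have hgw := hc p q w
  rw [h0.1, h0.2, hw, inner_zero_left] at hgw
  refine (mul_eq_zero.1 (?_ : (inner ℝ q.1 x - q.2) * _ = 0)).resolve_left (hx q hq)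
  linarith

/-- The nontrivial half of the contact axiom for joins. It fails for general regular closed sets;
the piecewise linear frontiers of polytopes are what makes it true. -/
theorem SC_union_right {A B C : Set (EuclideanSpace ℝ (Fin n))} (hn : 0 < n) (hA : IsPolytope A)
    (hB : IsPolytope B) (hC : IsPolytope C) (h : SC A (B ∪ C)) : SC A B ∨ SC A C := by
  classical
  obtain ⟨E, hEo, hEc, hE, hEA, hED⟩ := h
  have hBC := hB.union hC
  obtain ⟨p, hpE, hpA, hpD⟩ := isPreconnected_closed_iff.1 hEc.isPreconnected A (B ∪ C)
    hA.isClosed hBC.isClosed hE hEA hED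
  obtain ⟨r, hr, hrE⟩ := Metric.isOpen_iff.1 hEo p hpE
  obtain ⟨PA, hPA, hPA'⟩ := hA.exists_frontier_subset
  obtain ⟨PB, hPB, hPB'⟩ := hB.exists_frontier_subset
  obtain ⟨PC, hPC, hPC'⟩ := hC.exists_frontier_subset
  have hPne : ∀ q ∈ PA ∪ PB ∪ PC, q.1 ≠ 0 := by
    intro q hq
    simp only [Finset.mem_union] at hq
    rcases hq with (hq | hq) | hq
    exacts [hPA q hq, hPB q hq, hPC q hq]
  have meets : ∀ S : Set (EuclideanSpace ℝ (Fin n)), IsPolytope S → p ∈ S →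
      (Metric.ball p r ∩ interior S).Nonempty := fun S hS hpS =>
    mem_closure_iff.1 (by rwa [← hS.reg_eq] at hpS) _ Metric.isOpen_ball (Metric.mem_ball_self hr)
  obtain ⟨z, hzU, hzA, hzD, hz⟩ := exists_mem_inter_generic (PA ∪ PB ∪ PC) hPne
    Metric.isOpen_ball (convex_ball p r) hA.isClosed hBC.isClosed (hrE.trans hE)
    (meets A hA hpA) (meets _ hBC hpD)
  -- a single hyperplane `⟪a, x⟫ = b` containing every hyperplane of the family through `z`
  obtain ⟨a, b, ha, hab⟩ : ∃ (a : EuclideanSpace ℝ (Fin n)) (b : ℝ), a ≠ 0 ∧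
      ∀ q ∈ PA ∪ PB ∪ PC, inner ℝ q.1 z - q.2 = 0 →
        ∀ w, inner ℝ q.1 w - q.2 = 0 → inner ℝ a w - b = 0 := by
    by_cases h : ∃ q ∈ PA ∪ PB ∪ PC, inner ℝ q.1 z - q.2 = 0
    · obtain ⟨q, hq, hqz⟩ := h
      exact ⟨q.1, q.2, hPne q hq, fun q' hq' hqz' => hz q hq q' hq' hqz hqz'⟩
    · exact ⟨EuclideanSpace.single ⟨0, hn⟩ 1, 0, by simp, fun q hq hqz => (h ⟨q, hq, hqz⟩).elim⟩
  have hWo : IsOpen (⋂ q ∈ (PA ∪ PB ∪ PC).filter fun q => inner ℝ q.1 z - q.2 ≠ 0,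
      {w : EuclideanSpace ℝ (Fin n) | inner ℝ q.1 w - q.2 ≠ 0}) :=
    isOpen_biInter_finset fun q _ => isOpen_affine_ne_zero _ _
  obtain ⟨ε, hε, hεW⟩ := Metric.isOpen_iff.1 hWo z (by simp)
  have hV : ∀ w ∈ Metric.ball z ε, ∀ q ∈ PA ∪ PB ∪ PC, inner ℝ q.1 w - q.2 = 0 →
      inner ℝ a w - b = 0 := by
    intro w hw q hq hqw
    refine hab q hq ?_ w hqw
    by_contra h
    exact Set.mem_iInter₂.1 (hεW hw) q (Finset.mem_filter.2 ⟨hq, h⟩) hqw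
  have hfA : ∀ w ∈ Metric.ball z ε, w ∈ frontier A → inner ℝ a w - b = 0 := by
    intro w hw hwf
    obtain ⟨q, hq, hqw⟩ := hPA' w hwf
    exact hV w hw q (by simp [hq]) hqw
  rcases hzD with hzB | hzC
  · left
    refine SC_of_mem_inter hA.reg_eq hB.reg_eq Metric.isOpen_ball (convex_ball z ε)
      (Metric.mem_ball_self hε) hzA hzB ha hfA fun w hw hwf => ?_
    obtain ⟨q, hq, hqw⟩ := hPB' w hwf
    exact hV w hw q (by simp [hq]) hqw
  · right
    refine SC_of_mem_inter hA.reg_eq hC.reg_eq Metric.isOpen_ball (convex_ball z ε)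
      (Metric.mem_ball_self hε) hzA hzC ha hfA fun w hw hwf => ?_
    obtain ⟨q, hq, hqw⟩ := hPC' w hwf
    exact hV w hw q (by simp [hq]) hqw

theorem SC_self {A : Set (EuclideanSpace ℝ (Fin n))} (hA : IsPolytope A) (hne : A.Nonempty) :
    SC A A := by
  have hi : (interior A).Nonempty := by
    rw [← hA.reg_eq] at hne
    exact closure_nonempty_iff.1 hne
  obtain ⟨x, hx⟩ := hi
  obtain ⟨r, hr, hrA⟩ := Metric.isOpen_iff.1 isOpen_interior x hx
  have hx' := Metric.mem_ball_self (x := x) hr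
  exact ⟨Metric.ball x r, Metric.isOpen_ball, ⟨⟨x, hx'⟩, (convex_ball x r).isPreconnected⟩,
    fun y hy => Or.inl (interior_subset (hrA hy)), ⟨x, hx', interior_subset hx⟩,
    ⟨x, hx', interior_subset hx⟩⟩

/-- The whole space witnesses the strong contact of `A` with its complement. -/
theorem SC_regCompl {A : Set (EuclideanSpace ℝ (Fin n))} (h0 : A.Nonempty) (h1 : A ≠ Set.univ) :
    SC A (regCompl A) := by
  obtain ⟨x, hx⟩ := h0
  obtain ⟨y, hy⟩ := (Set.ne_univ_iff_exists_notMem A).1 h1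
  have hs : Aᶜ ⊆ regCompl A := subset_closure
  refine ⟨Set.univ, isOpen_univ, isConnected_univ, fun z _ => ?_, ⟨x, trivial, hx⟩,
    ⟨y, trivial, hs hy⟩⟩
  by_cases hz : z ∈ A
  exacts [Or.inl hz, Or.inr (hs hz)]

end Distributivity

/-! ### Soundness -/

theorem IsAxiom.trueIn {n : ℕ} (hn : 0 < n) {φ : Formula} (h : IsAxiom φ) : φ.TrueIn (PSC n) := by
  intro v
  induction h
  case contact_zero a =>
    rintro ⟨E, -, -, -, ⟨x, -, hx⟩, -⟩
    exact (coe_value_zero v).subset hx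
  case zero_ne_one =>
    intro h
    exact Set.empty_ne_univ ((coe_value_zero v).symm.trans
      ((congrArg Subtype.val h).trans (coe_value_one v)))
  case contact_join a b c =>
    have key : SC (value v a).1 ((value v b).1 ∪ (value v c).1) ↔
        SC (value v a).1 (value v b).1 ∨ SC (value v a).1 (value v c).1 :=
      ⟨SC_union_right hn (value v a).2 (value v b).2 (value v c).2,
        fun h => h.elim (SC.mono_right Set.subset_union_left)
          (SC.mono_right Set.subset_union_right)⟩
    have h1 : Formula.TrueUnder (PSC n) v (.contact a (b.join c)) ↔
        (Formula.TrueUnder (PSC n) v (.contact a b) ∨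
          Formula.TrueUnder (PSC n) v (.contact a c)) := key
    simp only [Formula.iff, Formula.conj, Formula.imp]
    simp only [Formula.TrueUnder] at h1 ⊢
    tauto
  case contact_symm a b =>
    exact or_iff_not_imp_left.2 fun h => SC.symm (not_not.1 h)
  case contact_self a =>
    refine or_iff_not_imp_left.2 fun h => SC_self (value v a).2 ?_
    by_contra hne
    exact h fun h0 => h0 (Subtype.ext
      ((Set.not_nonempty_iff_eq_empty.1 hne).trans (coe_value_zero v).symm))
  case connected a =>
    refine or_iff_not_imp_left.2 fun h => or_iff_not_imp_left.2 fun h' => SC_regCompl ?_ ?_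
    · by_contra hne
      exact h fun h0 => h0 (Subtype.ext
        ((Set.not_nonempty_iff_eq_empty.1 hne).trans (coe_value_zero v).symm))
    · intro hu
      exact h' fun h1 => h1 (Subtype.ext (hu.trans (coe_value_one v).symm))
  case eq_compl a b =>
    refine or_iff_not_imp_left.2 fun h => ?_
    have h' : a.val (PSC n) v = b.val (PSC n) v := not_not.1 h
    simp [Formula.TrueUnder, Term.val, h']
  case eq_join a b c d =>
    refine or_iff_not_imp_left.2 fun h => or_iff_not_imp_left.2 fun h2 => ?_
    have h' : a.val (PSC n) v = b.val (PSC n) v := not_not.1 h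
    have h2' : c.val (PSC n) v = d.val (PSC n) v := not_not.1 h2
    simp [Formula.TrueUnder, Term.val, h', h2']
  case eq_contact a b c d =>
    refine or_iff_not_imp_left.2 fun h => or_iff_not_imp_left.2 fun h2 => ?_
    have h' : a.val (PSC n) v = b.val (PSC n) v := not_not.1 h
    have h2' : c.val (PSC n) v = d.val (PSC n) v := not_not.1 h2
    simp only [Formula.imp, Formula.TrueUnder, h', h2']
    tauto
  case eq_symm a b =>
    exact or_iff_not_imp_left.2 fun h => (not_not.1 h).symm
  case eq_trans a b c =>
    exact or_iff_not_imp_left.2 fun h => or_iff_not_imp_left.2 fun h2 =>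
      (not_not.1 h).trans (not_not.1 h2)
  case eq_refl a => rfl
  case join_assoc =>
    exact value_ext (by simp only [regInt_value_join, sup_assoc])
  case meet_assoc =>
    exact value_ext (by simp only [regInt_value_meet, inf_assoc])
  case join_comm =>
    exact value_ext (by simp only [regInt_value_join, sup_comm])
  case meet_comm =>
    exact value_ext (by simp only [regInt_value_meet, inf_comm])
  case join_absorb =>
    exact value_ext (by simp only [regInt_value_join, regInt_value_meet, sup_inf_self])
  case meet_absorb =>
    exact value_ext (by simp only [regInt_value_join, regInt_value_meet, inf_sup_self])
  case meet_distrib =>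
    exact value_ext (by simp only [regInt_value_join, regInt_value_meet, inf_sup_left])
  case join_distrib =>
    exact value_ext (by simp only [regInt_value_join, regInt_value_meet, sup_inf_left])
  case join_compl =>
    exact value_ext (by simp only [regInt_value_join, regInt_value_compl, regInt_value_one,
      sup_compl_eq_top])
  case meet_compl =>
    exact value_ext (by simp only [regInt_value_meet, regInt_value_compl, regInt_value_zero,
      inf_compl_eq_bot])
  all_goals
    simp only [Formula.imp, Formula.TrueUnder]
    tauto

theorem IsTheorem.trueIn {n : ℕ} (hn : 0 < n) {φ : Formula} (h : IsTheorem φ) :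
    φ.TrueIn (PSC n) := by
  induction h with
  | ax h => exact h.trueIn hn
  | mp _ _ ih1 ih2 => exact fun v => (ih2 v).resolve_left (not_not.2 (ih1 v))

/-! ### Maximal theories -/

/-- Derivability from the axioms and the additional hypotheses `Γ`. -/
inductive Derives (Γ : Set Formula) : Formula → Prop where
  | ax {φ : Formula} : IsAxiom φ → Derives Γ φ
  | hyp {φ : Formula} : φ ∈ Γ → Derives Γ φ
  | mp {φ ψ : Formula} : Derives Γ φ → Derives Γ (Formula.imp φ ψ) → Derives Γ ψ

namespace Derives

variable {Γ Δ : Set Formula} {φ ψ χ : Formula}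

theorem isTheorem (h : Derives ∅ φ) : IsTheorem φ := by
  induction h with
  | ax h => exact .ax h
  | hyp h => exact h.elim
  | mp _ _ h1 h2 => exact .mp h1 h2

theorem mono (hΓ : Γ ⊆ Δ) (h : Derives Γ φ) : Derives Δ φ := by
  induction h with
  | ax h => exact .ax h
  | hyp h => exact .hyp (hΓ h)
  | mp _ _ h1 h2 => exact .mp h1 h2

theorem imp_self (φ : Formula) : Derives Γ (Formula.imp φ φ) :=
  .mp (.ax (.prop_k φ φ)) (.mp (.ax (.prop_k φ (.imp φ φ))) (.ax (.prop_s φ (.imp φ φ) φ)))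

theorem imp_of (h : Derives Γ ψ) : Derives Γ (Formula.imp φ ψ) :=
  .mp h (.ax (.prop_k ψ φ))

/-- The deduction theorem. -/
theorem deduction (h : Derives (insert φ Γ) ψ) : Derives Γ (Formula.imp φ ψ) := by
  induction h with
  | ax h => exact imp_of (.ax h)
  | hyp h =>
    rcases h with rfl | h
    exacts [imp_self _, imp_of (.hyp h)]
  | mp _ _ h1 h2 => exact .mp h1 (.mp h2 (.ax (.prop_s _ _ _)))

theorem exists_of_sUnion {c : Set (Set Formula)} (hc : IsChain (· ⊆ ·) c) (hne : c.Nonempty)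
    (h : Derives (⋃₀ c) φ) : ∃ Γ ∈ c, Derives Γ φ := by
  induction h with
  | ax h => exact ⟨hne.some, hne.some_mem, .ax h⟩
  | hyp h =>
    obtain ⟨Γ, hΓ, h⟩ := h
    exact ⟨Γ, hΓ, .hyp h⟩
  | mp _ _ h1 h2 =>
    obtain ⟨Γ, hΓ, h1⟩ := h1
    obtain ⟨Δ, hΔ, h2⟩ := h2
    rcases hc.total hΓ hΔ with h | h
    exacts [⟨Δ, hΔ, .mp (h1.mono h) h2⟩, ⟨Γ, hΓ, .mp h1 (h2.mono h)⟩]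

end Derives

/-- A maximal theory: a set of formulas that contains the axioms and obeys the truth tables of
negation and disjunction. -/
structure IsMaximalTheory (T : Set Formula) : Prop where
  ax {φ : Formula} : IsAxiom φ → φ ∈ T
  neg_iff (φ : Formula) : φ.neg ∈ T ↔ φ ∉ T
  disj_iff (φ ψ : Formula) : φ.disj ψ ∈ T ↔ φ ∈ T ∨ ψ ∈ T

open Formula in
/-- Lindenbaum's lemma: a set of hypotheses maximal among those that do not derive `φ` is a maximal
theory. -/
theorem exists_isMaximalTheory {φ : Formula} (hφ : ¬ IsTheorem φ) :
    ∃ T, IsMaximalTheory T ∧ φ ∉ T := by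
  obtain ⟨T, -, hT, hmax⟩ := zorn_subset_nonempty {Γ | ¬ Derives Γ φ}
    (fun c hc hch hne => ⟨⋃₀ c, fun h => by
      obtain ⟨Γ, hΓ, h⟩ := h.exists_of_sUnion hch hne
      exact hc hΓ h, fun Γ hΓ => Set.subset_sUnion_of_mem hΓ⟩)
    ∅ (fun h => hφ h.isTheorem)
  have hT' : ¬ Derives T φ := hT
  have himp : ∀ ψ, ψ ∉ T → Derives T (imp ψ φ) := by
    intro ψ hψ
    refine Derives.deduction ?_
    by_contra h
    exact hψ (hmax (y := insert ψ T) h (Set.subset_insert _ _) (Set.mem_insert _ _))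
  have hder : ∀ ψ, Derives T ψ → ψ ∈ T := by
    intro ψ h
    by_contra hψ
    exact hT' (.mp h (himp ψ hψ))
  have hcases : ∀ ψ χ, ψ.disj χ ∈ T → ψ ∈ T ∨ χ ∈ T := by
    intro ψ χ h
    by_contra! hn
    exact hT' (.mp (.hyp h)
      (.mp (himp _ hn.2) (.mp (himp _ hn.1) (.ax (.prop_cases ψ χ φ)))))
  refine ⟨T, ⟨fun h => hder _ (.ax h), fun ψ => ⟨fun hn h => ?_, fun h => ?_⟩,
    fun ψ χ => ⟨hcases ψ χ, ?_⟩⟩, fun h => hT' (.hyp h)⟩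
  · -- from `ψ` and `¬ψ` everything follows
    exact hT' (.mp (.hyp h)
      (.mp (.mp (.hyp hn) (.ax (.prop_k _ (neg φ)))) (.ax (.prop_contrapose φ ψ))))
  · -- `ψ ⇒ ψ` abbreviates the excluded middle `¬ψ ∨ ψ`
    exact (hcases _ _ (hder _ (Derives.imp_self ψ))).resolve_right h
  · rintro (h | h)
    exacts [hder _ (.mp (.hyp h) (.ax (.prop_inl ψ χ))),
      hder _ (.mp (.hyp h) (.ax (.prop_inr ψ χ)))]

namespace IsMaximalTheory

variable {T : Set Formula} (hT : IsMaximalTheory T)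
include hT

theorem imp_iff (φ ψ : Formula) : φ.imp ψ ∈ T ↔ (φ ∈ T → ψ ∈ T) := by
  rw [Formula.imp, hT.disj_iff, hT.neg_iff, imp_iff_not_or]

theorem conj_iff (φ ψ : Formula) : φ.conj ψ ∈ T ↔ φ ∈ T ∧ ψ ∈ T := by
  rw [Formula.conj, hT.neg_iff, hT.disj_iff, hT.neg_iff, hT.neg_iff]
  tauto

theorem iff_iff (φ ψ : Formula) : φ.iff ψ ∈ T ↔ (φ ∈ T ↔ ψ ∈ T) := by
  rw [Formula.iff, hT.conj_iff, hT.imp_iff, hT.imp_iff]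
  tauto

theorem eq_symm {a b : Term} (h : .eq a b ∈ T) : .eq b a ∈ T :=
  (hT.imp_iff _ _).1 (hT.ax (.eq_symm a b)) h

theorem eq_trans {a b c : Term} (h : .eq a b ∈ T) (h' : .eq b c ∈ T) : .eq a c ∈ T :=
  (hT.imp_iff _ _).1 ((hT.imp_iff _ _).1 (hT.ax (.eq_trans a b c)) h) h'

theorem eq_compl {a b : Term} (h : .eq a b ∈ T) : .eq a.compl b.compl ∈ T :=
  (hT.imp_iff _ _).1 (hT.ax (.eq_compl a b)) h

theorem eq_join {a b c d : Term} (h : .eq a b ∈ T) (h' : .eq c d ∈ T) :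
    .eq (a.join c) (b.join d) ∈ T :=
  (hT.imp_iff _ _).1 ((hT.imp_iff _ _).1 (hT.ax (.eq_join a b c d)) h) h'

theorem eq_meet {a b c d : Term} (h : .eq a b ∈ T) (h' : .eq c d ∈ T) :
    .eq (a.meet c) (b.meet d) ∈ T :=
  hT.eq_compl (hT.eq_join (hT.eq_compl h) (hT.eq_compl h'))

theorem contact_congr {a b c d : Term} (h : .eq a b ∈ T) (h' : .eq c d ∈ T)
    (hc : .contact a c ∈ T) : .contact b d ∈ T :=
  (hT.imp_iff _ _).1 ((hT.imp_iff _ _).1 ((hT.imp_iff _ _).1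
    (hT.ax (.eq_contact a b c d)) h) h') hc

end IsMaximalTheory

/-! ### The Lindenbaum algebra -/

/-- The congruence on terms given by the equations in a maximal theory. -/
def lindenbaumSetoid {T : Set Formula} (hT : IsMaximalTheory T) : Setoid Term where
  r a b := Formula.eq a b ∈ T
  iseqv := ⟨fun a => hT.ax (.eq_refl a), hT.eq_symm, hT.eq_trans⟩

/-- The terms modulo equality in a maximal theory. -/
def Lindenbaum {T : Set Formula} (hT : IsMaximalTheory T) : Type := Quotient (lindenbaumSetoid hT)

namespace Lindenbaum

variable {T : Set Formula} (hT : IsMaximalTheory T)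

/-- The class of a term in the Lindenbaum algebra. -/
def mk (a : Term) : Lindenbaum hT := Quotient.mk (lindenbaumSetoid hT) a

variable {hT}

theorem mk_eq_mk {a b : Term} : mk hT a = mk hT b ↔ .eq a b ∈ T :=
  ⟨fun h => Quotient.exact (s := lindenbaumSetoid hT) h,
    fun h => Quotient.sound (s := lindenbaumSetoid hT) h⟩

theorem exists_mk (x : Lindenbaum hT) : ∃ a, mk hT a = x := Quotient.exists_rep x

theorem mk_eq_of_ax {a b : Term} (h : IsAxiom (.eq a b)) : mk hT a = mk hT b :=
  mk_eq_mk.2 (hT.ax h)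

variable (hT) in
/-- The lattice structure of the Lindenbaum algebra. -/
abbrev lattice : Lattice (Lindenbaum hT) :=
  letI : Max (Lindenbaum hT) := ⟨Quotient.map₂ Term.join fun _ _ h _ _ h' => hT.eq_join h h'⟩
  letI : Min (Lindenbaum hT) := ⟨Quotient.map₂ Term.meet fun _ _ h _ _ h' => hT.eq_meet h h'⟩
  Lattice.mk'
    (by rintro ⟨a⟩ ⟨b⟩; exact mk_eq_of_ax (.join_comm a b))
    (by rintro ⟨a⟩ ⟨b⟩ ⟨c⟩; exact (mk_eq_of_ax (.join_assoc a b c)).symm)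
    (by rintro ⟨a⟩ ⟨b⟩; exact mk_eq_of_ax (.meet_comm a b))
    (by rintro ⟨a⟩ ⟨b⟩ ⟨c⟩; exact (mk_eq_of_ax (.meet_assoc a b c)).symm)
    (by rintro ⟨a⟩ ⟨b⟩; exact mk_eq_of_ax (.join_absorb a b))
    (by rintro ⟨a⟩ ⟨b⟩; exact mk_eq_of_ax (.meet_absorb a b))

instance : BooleanAlgebra (Lindenbaum hT) :=
  letI := lattice hT
  letI : DistribLattice (Lindenbaum hT) := DistribLattice.ofInfSupLe (by
    rintro ⟨a⟩ ⟨b⟩ ⟨c⟩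
    exact le_of_eq (mk_eq_of_ax (.meet_distrib a b c)))
  { compl := Quotient.map Term.compl fun _ _ h => hT.eq_compl h
    top := mk hT Term.one
    bot := mk hT Term.zero
    le_top := by
      rintro ⟨a⟩
      exact (le_sup_left (b := mk hT a.compl)).trans_eq (mk_eq_of_ax (.join_compl a))
    bot_le := by
      rintro ⟨a⟩
      exact (mk_eq_of_ax (.meet_compl a)).symm.trans_le (inf_le_left (b := mk hT a.compl))
    inf_compl_le_bot := by
      rintro ⟨a⟩
      exact (mk_eq_of_ax (.meet_compl a)).le
    top_le_sup_compl := by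
      rintro ⟨a⟩
      exact (mk_eq_of_ax (.join_compl a)).ge }

theorem mk_join (a b : Term) : mk hT (a.join b) = mk hT a ⊔ mk hT b := rfl

theorem mk_compl (a : Term) : mk hT a.compl = (mk hT a)ᶜ := rfl

theorem mk_zero : mk hT Term.zero = ⊥ := rfl

theorem mk_one : mk hT Term.one = ⊤ := rfl

end Lindenbaum

/-! ### Connected contact algebras and their finite quotients -/

/-- Connected contact relations on a Boolean algebra. -/
structure IsConnectedContact {B : Type*} [BooleanAlgebra B] (C : B → B → Prop) : Prop where
  bot_left (x : B) : ¬ C ⊥ x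
  sup_right (x y z : B) : C x (y ⊔ z) ↔ C x y ∨ C x z
  symm {x y : B} : C x y → C y x
  self {x : B} : x ≠ ⊥ → C x x
  connected {x : B} : x ≠ ⊥ → x ≠ ⊤ → C x xᶜ

/-- The contact relation of the Lindenbaum algebra. -/
def Lindenbaum.Contact {T : Set Formula} {hT : IsMaximalTheory T} (x y : Lindenbaum hT) : Prop :=
  ∃ a b, mk hT a = x ∧ mk hT b = y ∧ Formula.contact a b ∈ T

theorem Lindenbaum.contact_mk {T : Set Formula} {hT : IsMaximalTheory T} {a b : Term} :
    Contact (mk hT a) (mk hT b) ↔ .contact a b ∈ T := by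
  refine ⟨?_, fun h => ⟨a, b, rfl, rfl, h⟩⟩
  rintro ⟨a', b', ha, hb, h⟩
  exact hT.contact_congr (mk_eq_mk.1 ha) (mk_eq_mk.1 hb) h

theorem Lindenbaum.isConnectedContact {T : Set Formula} (hT : IsMaximalTheory T) :
    IsConnectedContact (Contact (hT := hT)) where
  bot_left x := by
    obtain ⟨a, rfl⟩ := exists_mk x
    rw [← mk_zero, contact_mk]
    exact (hT.neg_iff _).1 (hT.ax (.contact_zero a))
  sup_right x y z := by
    obtain ⟨a, rfl⟩ := exists_mk x
    obtain ⟨b, rfl⟩ := exists_mk y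
    obtain ⟨c, rfl⟩ := exists_mk z
    rw [← mk_join, contact_mk, contact_mk, contact_mk, ← hT.disj_iff]
    exact (hT.iff_iff _ _).1 (hT.ax (.contact_join a b c))
  symm {x y} := by
    obtain ⟨a, rfl⟩ := exists_mk x
    obtain ⟨b, rfl⟩ := exists_mk y
    rw [contact_mk, contact_mk]
    exact (hT.imp_iff _ _).1 (hT.ax (.contact_symm a b))
  self {x} := by
    obtain ⟨a, rfl⟩ := exists_mk x
    rw [contact_mk, ← mk_zero, Ne, mk_eq_mk, ← hT.neg_iff]
    exact (hT.imp_iff _ _).1 (hT.ax (.contact_self a))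
  connected {x} := by
    obtain ⟨a, rfl⟩ := exists_mk x
    rw [← mk_compl, contact_mk, ← mk_zero, ← mk_one, Ne, Ne, mk_eq_mk, mk_eq_mk, ← hT.neg_iff,
      ← hT.neg_iff, ← hT.imp_iff]
    exact (hT.imp_iff _ _).1 (hT.ax (.connected a))

/-- The minterm of a family `p` of elements of a Boolean algebra that contains `p i` for the
`i ∈ s` and the complement of `p i` for the remaining `i ∈ M`. -/
def minterm {B : Type*} [BooleanAlgebra B] (p : ℕ → B) (M s : Finset ℕ) : B :=
  M.inf fun i => if i ∈ s then p i else (p i)ᶜ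

section Minterm

variable {B : Type*} [BooleanAlgebra B] {p : ℕ → B} {M : Finset ℕ}

/-- A predicate that distributes over binary joins, such as being nonzero or being in contact with
a given element, passes from `x` to the meet of `x` with some minterm. -/
theorem exists_inf_minterm {G : B → Prop} (hG : ∀ x y, G (x ⊔ y) → G x ∨ G y) (M : Finset ℕ)
    {x : B} (hx : G x) : ∃ s ⊆ M, G (x ⊓ minterm p M s) := by
  induction M using Finset.induction_on generalizing x with
  | empty => exact ⟨∅, subset_rfl, by simpa [minterm] using hx⟩
  | insert i M hi ih =>
    rw [← sup_inf_inf_compl (x := x) (y := p i)] at hx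
    rcases hG _ _ hx with h | h
    · obtain ⟨s, hs, h⟩ := ih h
      refine ⟨insert i s, Finset.insert_subset_insert _ hs, ?_⟩
      have : minterm p M (insert i s) = minterm p M s := by
        refine Finset.inf_congr rfl fun j hj => ?_
        have : j ≠ i := fun h => hi (h ▸ hj)
        simp [this]
      rw [minterm, Finset.inf_insert, ← minterm, this]
      simpa [inf_assoc] using h
    · obtain ⟨s, hs, h⟩ := ih h
      refine ⟨s, hs.trans (Finset.subset_insert _ _), ?_⟩
      rw [minterm, Finset.inf_insert, ← minterm, if_neg fun h => hi (hs h)]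
      simpa [inf_assoc] using h

theorem minterm_le {s : Finset ℕ} {i : ℕ} (hi : i ∈ M) (his : i ∈ s) : minterm p M s ≤ p i :=
  (Finset.inf_le hi).trans (by simp [his])

theorem minterm_le_compl {s : Finset ℕ} {i : ℕ} (hi : i ∈ M) (his : i ∉ s) :
    minterm p M s ≤ (p i)ᶜ :=
  (Finset.inf_le hi).trans (by simp [his])

theorem disjoint_minterm {s t : Finset ℕ} (hs : s ⊆ M) (ht : t ⊆ M) (hst : s ≠ t) :
    Disjoint (minterm p M s) (minterm p M t) := by
  obtain ⟨i, hi⟩ : ∃ i, ¬ (i ∈ s ↔ i ∈ t) := by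
    by_contra! h
    exact hst (Finset.ext h)
  by_cases his : i ∈ s
  · have hit : i ∉ t := fun h => hi ⟨fun _ => h, fun _ => his⟩
    exact disjoint_compl_right.mono (minterm_le (hs his) his) (minterm_le_compl (hs his) hit)
  · have hit : i ∈ t := by tauto
    exact disjoint_compl_left.mono (minterm_le_compl (ht hit) his) (minterm_le (ht hit) hit)

namespace IsConnectedContact

variable {C : B → B → Prop} (hC : IsConnectedContact C)
include hC

theorem mono_right {x y z : B} (h : y ≤ z) (hxy : C x y) : C x z := by
  rw [← sup_eq_right.2 h, hC.sup_right]
  exact Or.inl hxy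

theorem mono {x y z w : B} (h : x ≤ z) (h' : y ≤ w) (hxy : C x y) : C z w :=
  hC.mono_right h' (hC.symm (hC.mono_right h (hC.symm hxy)))

theorem ne_bot_left {x y : B} (h : C x y) : x ≠ ⊥ := by
  rintro rfl
  exact hC.bot_left _ h

theorem exists_minterm (p : ℕ → B) (M : Finset ℕ) {x y : B} (h : C x y) :
    ∃ s ⊆ M, ∃ t ⊆ M, C (x ⊓ minterm p M s) (y ⊓ minterm p M t) := by
  obtain ⟨t, ht, h⟩ := exists_inf_minterm (p := p) (G := C x)
    (fun y z => (hC.sup_right x y z).1) M h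
  obtain ⟨s, hs, h⟩ := exists_inf_minterm (p := p) (G := C (y ⊓ minterm p M t))
    (fun y z => (hC.sup_right _ y z).1) M (hC.symm h)
  exact ⟨s, hs, t, ht, hC.symm h⟩

/-- The contact graph on the nonzero minterms is connected: the join of the minterms reachable from
a given one is in no contact with the remaining ones, so it is the top element. -/
theorem reflTransGen_minterm {s t : Finset ℕ} (hs : s ⊆ M) (ht : t ⊆ M)
    (hs0 : minterm p M s ≠ ⊥) (ht0 : minterm p M t ≠ ⊥) :
    Relation.ReflTransGen
      (fun u w => (u ⊆ M ∧ w ⊆ M) ∧ C (minterm p M u) (minterm p M w)) s t := by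
  classical
  set r : Finset ℕ → Finset ℕ → Prop :=
    fun u w => (u ⊆ M ∧ w ⊆ M) ∧ C (minterm p M u) (minterm p M w) with hr
  by_contra hst
  set R := M.powerset.filter fun u => Relation.ReflTransGen r s u with hR
  set x := R.sup (minterm p M) with hx
  have hdisj : ∀ u ⊆ M, u ∉ R → Disjoint (minterm p M u) x := by
    intro u hu huR
    rw [hx, Finset.disjoint_sup_right]
    intro w hw
    exact disjoint_minterm hu (Finset.mem_powerset.1 (Finset.mem_filter.1 hw).1)
      fun h => huR (h ▸ hw)
  have hle : ∀ u ∈ R, minterm p M u ≤ x := fun u hu => Finset.le_sup (f := minterm p M) hu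
  have hx0 : x ≠ ⊥ := by
    intro h
    exact hs0 (le_bot_iff.1 (h ▸ hle s (by simp [hR, hs, Relation.ReflTransGen.refl])))
  have hx1 : x ≠ ⊤ := by
    intro h
    have := hdisj t ht (by simp [hR, hst])
    rw [h, disjoint_top] at this
    exact ht0 this
  obtain ⟨u, hu, w, hw, huw⟩ := hC.exists_minterm p M (hC.connected hx0 hx1)
  have huR : u ∈ R := by
    by_contra h
    exact hC.ne_bot_left huw (by rw [inf_comm]; exact (hdisj u hu h).eq_bot)
  have hwR : w ∉ R := by
    intro h
    refine hC.ne_bot_left (hC.symm huw) (Disjoint.eq_bot ?_)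
    exact disjoint_compl_left.mono_right (hle w h)
  refine hwR (Finset.mem_filter.2 ⟨Finset.mem_powerset.2 hw, ?_⟩)
  exact (Finset.mem_filter.1 huR).2.tail ⟨⟨hu, hw⟩, hC.mono inf_le_right inf_le_right huw⟩

end IsConnectedContact

end Minterm

/-! ### Finite graph models -/

/-- The variables of a term. -/
def Term.vars : Term → Finset ℕ
  | .var i => {i}
  | .compl a => a.vars
  | .join a b => a.vars ∪ b.vars

/-- The variables of a formula. -/
def Formula.vars : Formula → Finset ℕ
  | .eq a b => a.vars ∪ b.vars
  | .contact a b => a.vars ∪ b.vars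
  | .neg φ => φ.vars
  | .disj φ ψ => φ.vars ∪ ψ.vars

/-- Membership of a point in the value of a term, where the point is given by the set `s` of the
variables whose values contain it. -/
def Term.Holds (s : Finset ℕ) : Term → Prop
  | .var i => i ∈ s
  | .compl a => ¬ a.Holds s
  | .join a b => a.Holds s ∨ b.Holds s

/-- Truth of a formula in the contact algebra of all subsets of the vertex set `W` of a graph `r`;
each vertex is itself the set of the variables whose values contain it. -/
def Formula.HoldsIn (W : Set (Finset ℕ)) (r : Finset ℕ → Finset ℕ → Prop) : Formula → Prop
  | .eq a b => ∀ s ∈ W, a.Holds s ↔ b.Holds s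
  | .contact a b => ∃ s t, r s t ∧ a.Holds s ∧ b.Holds t
  | .neg φ => ¬ φ.HoldsIn W r
  | .disj φ ψ => φ.HoldsIn W r ∨ ψ.HoldsIn W r

section GraphModel

variable {T : Set Formula} {hT : IsMaximalTheory T}

open Lindenbaum

/-- The minterms of the Lindenbaum algebra over the variables in `M`. -/
def termMinterm (hT : IsMaximalTheory T) (M s : Finset ℕ) : Lindenbaum hT :=
  minterm (fun i => mk hT (.var i)) M s

theorem termMinterm_le {M s : Finset ℕ} (a : Term) (ha : a.vars ⊆ M) :
    (a.Holds s → termMinterm hT M s ≤ mk hT a) ∧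
      (¬ a.Holds s → termMinterm hT M s ≤ (mk hT a)ᶜ) := by
  induction a with
  | var i =>
    have hi : i ∈ M := ha (Finset.mem_singleton_self i)
    exact ⟨fun h => minterm_le hi h, fun h => minterm_le_compl hi h⟩
  | compl a ih =>
    rw [mk_compl, compl_compl]
    exact ⟨(ih ha).2, fun h => (ih ha).1 (not_not.1 h)⟩
  | join a b iha ihb =>
    have iha := iha (Finset.union_subset_left ha)
    have ihb := ihb (Finset.union_subset_right ha)
    rw [mk_join, compl_sup]
    refine ⟨?_, fun h => le_inf (iha.2 fun h' => h (Or.inl h')) (ihb.2 fun h' => h (Or.inr h'))⟩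
    rintro (h | h)
    exacts [(iha.1 h).trans le_sup_left, (ihb.1 h).trans le_sup_right]

theorem holds_of_inf_ne_bot {M s : Finset ℕ} {a : Term} (ha : a.vars ⊆ M)
    (h : mk hT a ⊓ termMinterm hT M s ≠ ⊥) : a.Holds s := by
  by_contra hn
  exact h (disjoint_compl_right.mono_right ((termMinterm_le a ha).2 hn)).eq_bot

theorem not_holds_of_inf_ne_bot {M s : Finset ℕ} {a : Term} (ha : a.vars ⊆ M)
    (h : (mk hT a)ᶜ ⊓ termMinterm hT M s ≠ ⊥) : ¬ a.Holds s := fun hn =>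
  h (disjoint_compl_left.mono_right ((termMinterm_le a ha).1 hn)).eq_bot

/-- The vertices of the graph of nonzero minterms. -/
def vertices (hT : IsMaximalTheory T) (M : Finset ℕ) : Set (Finset ℕ) :=
  {s | s ⊆ M ∧ termMinterm hT M s ≠ ⊥}

/-- The edges of the graph of nonzero minterms. -/
def Edge (hT : IsMaximalTheory T) (M s t : Finset ℕ) : Prop :=
  (s ⊆ M ∧ t ⊆ M) ∧ Contact (termMinterm hT M s) (termMinterm hT M t)

theorem le_of_forall_vertices {M : Finset ℕ} {a b : Term} (ha : a.vars ⊆ M) (hb : b.vars ⊆ M)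
    (h : ∀ s ∈ vertices hT M, a.Holds s → b.Holds s) : mk hT a ≤ mk hT b := by
  rw [← disjoint_compl_right_iff, disjoint_iff]
  by_contra hne
  obtain ⟨s, hs, hne⟩ := exists_inf_minterm (p := fun i => mk hT (.var i)) (G := fun x => x ≠ ⊥)
    (fun x y h => by by_contra! h'; exact h (by rw [h'.1, h'.2, sup_bot_eq])) M hne
  change mk hT a ⊓ (mk hT b)ᶜ ⊓ termMinterm hT M s ≠ ⊥ at hne
  refine not_holds_of_inf_ne_bot hb (s := s) (ne_bot_of_le_ne_bot hne ?_)
    (h s ⟨hs, ne_bot_of_le_ne_bot hne inf_le_right⟩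
      (holds_of_inf_ne_bot ha (ne_bot_of_le_ne_bot hne ?_)))
  exacts [inf_le_inf_right _ inf_le_right, inf_le_inf_right _ inf_le_left]

theorem mem_iff_holdsIn {M : Finset ℕ} (φ : Formula) (hφ : φ.vars ⊆ M) :
    φ ∈ T ↔ φ.HoldsIn (vertices hT M) (Edge hT M) := by
  have hC := isConnectedContact hT
  induction φ with
  | eq a b =>
    have ha := Finset.union_subset_left hφ
    have hb := Finset.union_subset_right hφ
    rw [← mk_eq_mk (hT := hT)]
    refine ⟨fun h s hs => ?_, fun h => le_antisymm
      (le_of_forall_vertices ha hb fun s hs => (h s hs).1)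
      (le_of_forall_vertices hb ha fun s hs => (h s hs).2)⟩
    have key : ∀ c d : Term, c.vars ⊆ M → d.vars ⊆ M → mk hT c = mk hT d → c.Holds s →
        d.Holds s := fun c d hc hd hcd h => holds_of_inf_ne_bot (hT := hT) hd (by
      rw [← hcd, inf_eq_right.2 ((termMinterm_le (hT := hT) c hc).1 h)]
      exact hs.2)
    exact ⟨key a b ha hb h, key b a hb ha h.symm⟩
  | contact a b =>
    have ha := Finset.union_subset_left hφ
    have hb := Finset.union_subset_right hφ
    rw [← contact_mk (hT := hT)]
    constructor
    · intro h
      obtain ⟨s, hs, t, ht, h⟩ := hC.exists_minterm (fun i => mk hT (.var i)) M h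
      exact ⟨s, t, ⟨⟨hs, ht⟩, hC.mono inf_le_right inf_le_right h⟩,
        holds_of_inf_ne_bot ha (hC.ne_bot_left h),
        holds_of_inf_ne_bot hb (hC.ne_bot_left (hC.symm h))⟩
    · rintro ⟨s, t, ⟨-, h⟩, hsa, htb⟩
      exact hC.mono ((termMinterm_le a ha).1 hsa) ((termMinterm_le b hb).1 htb) h
  | neg φ ih => exact (hT.neg_iff φ).trans (not_congr (ih hφ))
  | disj φ ψ ih1 ih2 =>
    exact (hT.disj_iff φ ψ).trans
      (or_congr (ih1 (Finset.union_subset_left hφ)) (ih2 (Finset.union_subset_right hφ)))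

theorem vertices_nonempty (hT : IsMaximalTheory T) (M : Finset ℕ) : (vertices hT M).Nonempty := by
  have h1 : (⊤ : Lindenbaum hT) ≠ ⊥ := fun h =>
    (hT.neg_iff _).1 (hT.ax .zero_ne_one) (mk_eq_mk.1 h.symm)
  obtain ⟨s, hs, hne⟩ := exists_inf_minterm (p := fun i => mk hT (.var i)) (G := fun x => x ≠ ⊥)
    (fun x y h => by by_contra! h'; exact h (by rw [h'.1, h'.2, sup_bot_eq])) M h1
  exact ⟨s, hs, ne_bot_of_le_ne_bot hne inf_le_right⟩

end GraphModel

/-! ### Walks through all edges of a finite connected graph -/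

theorem exists_list_walk {α : Type*} {r : α → α → Prop} {W : Set α}
    (hW : ∀ x y, r x y → x ∈ W ∧ y ∈ W)
    (hconn : ∀ x ∈ W, ∀ y ∈ W, Relation.ReflTransGen r x y) (F : Finset (α × α))
    (hF : ∀ e ∈ F, r e.1 e.2) (x : α) (hx : x ∈ W) :
    ∃ l : List α, (x :: l).IsChain r ∧ (∀ y ∈ x :: l, y ∈ W) ∧
      ∀ e ∈ F, ∃ i, (x :: l)[i]? = some e.1 ∧ (x :: l)[i + 1]? = some e.2 := by
  classical
  induction F using Finset.induction_on generalizing x with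
  | empty => exact ⟨[], by simp, by simpa using hx, by simp⟩
  | insert e F _ ih =>
    have he := hF e (Finset.mem_insert_self _ _)
    -- a walk through `F` from the end of `e` is preceded by `e` and by a walk from `x` to `e`
    refine (hconn x hx _ (hW _ _ he).1).head_induction_on ?_ ?_
    · obtain ⟨l, hl, hlW, hlF⟩ := ih (fun e' h => hF e' (Finset.mem_insert_of_mem h)) e.2
        (hW _ _ he).2
      refine ⟨e.2 :: l, hl.cons_cons he, ?_, fun e' he' => ?_⟩
      · intro y hy
        rcases List.mem_cons.1 hy with rfl | hy
        exacts [(hW _ _ he).1, hlW y hy]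
      · rcases Finset.mem_insert.1 he' with rfl | he'
        · exact ⟨0, by simp⟩
        · obtain ⟨i, hi⟩ := hlF e' he'
          exact ⟨i + 1, by simpa using hi⟩
    · rintro y z hyz - ⟨l, hl, hlW, hlF⟩
      refine ⟨z :: l, hl.cons_cons hyz, ?_, fun e' he' => ?_⟩
      · intro w hw
        rcases List.mem_cons.1 hw with rfl | hw
        exacts [(hW _ _ hyz).1, hlW w hw]
      · obtain ⟨i, hi⟩ := hlF e' he'
        exact ⟨i + 1, by simpa using hi⟩

theorem exists_walk {α : Type*} {r : α → α → Prop} {W : Set α} (hfin : W.Finite)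
    (hne : W.Nonempty) (hW : ∀ x y, r x y → x ∈ W ∧ y ∈ W)
    (hconn : ∀ x ∈ W, ∀ y ∈ W, Relation.ReflTransGen r x y) :
    ∃ (f : ℕ → α) (N : ℕ), (∀ i ≤ N, f i ∈ W) ∧ (∀ i < N, r (f i) (f (i + 1))) ∧
      ∀ x y, r x y → ∃ i < N, f i = x ∧ f (i + 1) = y := by
  classical
  obtain ⟨x, hx⟩ := hne
  have hF : {e : α × α | r e.1 e.2}.Finite :=
    (hfin.prod hfin).subset fun e he => ⟨(hW _ _ he).1, (hW _ _ he).2⟩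
  obtain ⟨l, hl, hlW, hlF⟩ := exists_list_walk hW hconn hF.toFinset
    (fun e he => by simpa using he) x hx
  have hget : ∀ i (h : i < (x :: l).length), (x :: l).getD i x = (x :: l)[i] := fun i h => by
    simp [List.getD, List.getElem?_eq_getElem h]
  refine ⟨fun i => (x :: l).getD i x, l.length, fun i hi => ?_, fun i hi => ?_, fun y z h => ?_⟩
  · have hi' : i < (x :: l).length := by simp; omega
    simp only [hget i hi']
    exact hlW _ (List.getElem_mem hi')
  · have hi' : i + 1 < (x :: l).length := by simp; omega
    simp only [hget i (by omega), hget (i + 1) hi']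
    exact List.isChain_iff_getElem.1 hl i hi'
  · obtain ⟨i, hi1, hi2⟩ := hlF (y, z) (by simpa using h)
    refine ⟨i, ?_, by simp [List.getD, hi1], by simp [List.getD, hi2]⟩
    have := (List.getElem?_eq_some_iff.1 hi2).1
    simp at this
    omega

/-! ### Subdivisions of `ℝⁿ` into slabs -/

section Slabs

variable {n : ℕ} (k : Fin n) (N : ℕ)

/-- The open slab `i < x k < j + 1`, without the lower bound if `i = 0` and without the upper bound
if `j = N`. -/
def openSlab (i j : ℕ) : Set (EuclideanSpace ℝ (Fin n)) :=
  {x | (i = 0 ∨ (i : ℝ) < x k) ∧ (j = N ∨ x k < j + 1)}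

/-- The `i`-th cell of the subdivision of `ℝⁿ` by the hyperplanes `x k = 1, …, x k = N`. -/
def cell (i : ℕ) : Set (EuclideanSpace ℝ (Fin n)) :=
  {x | (i = 0 ∨ (i : ℝ) ≤ x k) ∧ (i = N ∨ x k ≤ i + 1)}

theorem isOpen_openSlab (i j : ℕ) : IsOpen (openSlab k N i j) := by
  have h : Continuous fun x : EuclideanSpace ℝ (Fin n) => x k := by fun_prop
  exact (isOpen_const (p := i = 0)).union (isOpen_lt continuous_const h) |>.inter
    ((isOpen_const (p := j = N)).union (isOpen_lt h continuous_const))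

theorem convex_openSlab (i j : ℕ) : Convex ℝ (openSlab k N i j) := by
  have h : ({t | (i = 0 ∨ (i : ℝ) < t) ∧ (j = N ∨ t < j + 1)} : Set ℝ).OrdConnected :=
    ⟨fun a ha b hb c hc => ⟨ha.1.imp_right fun h => h.trans_le hc.1,
      hb.2.imp_right fun h => hc.2.trans_lt h⟩⟩
  exact h.convex.linear_preimage
    (EuclideanSpace.proj k : EuclideanSpace ℝ (Fin n) →L[ℝ] ℝ).toLinearMap

theorem isClosed_cell (i : ℕ) : IsClosed (cell k N i) := by
  have h : Continuous fun x : EuclideanSpace ℝ (Fin n) => x k := by fun_prop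
  exact (isClosed_const (p := i = 0)).union (isClosed_le continuous_const h) |>.inter
    ((isClosed_const (p := i = N)).union (isClosed_le h continuous_const))

theorem openSlab_subset_cell (i : ℕ) : openSlab k N i i ⊆ cell k N i := fun _ hx =>
  ⟨hx.1.imp_right le_of_lt, hx.2.imp_right le_of_lt⟩

/-- A point in the middle of the `i`-th cell. -/
noncomputable def mid (i : ℕ) : EuclideanSpace ℝ (Fin n) := EuclideanSpace.single k (i + 1 / 2 : ℝ)

theorem mid_apply (i : ℕ) : (mid k i : EuclideanSpace ℝ (Fin n)) k = i + 1 / 2 := by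
  simp [mid]

theorem mid_mem_openSlab {i j l : ℕ} (hi : i ≤ l) (hl : l ≤ j) : mid k l ∈ openSlab k N i j := by
  have h1 : (i : ℝ) ≤ l := by exact_mod_cast hi
  have h2 : (l : ℝ) ≤ j := by exact_mod_cast hl
  refine ⟨Or.inr ?_, Or.inr ?_⟩ <;> rw [mid_apply] <;> linarith

/-- Every point of a cell is a limit of points of the open slab, along the segment to the middle. -/
theorem cell_subset_closure (i : ℕ) : cell k N i ⊆ closure (openSlab k N i i) := by
  intro x hx
  have ht : Filter.Tendsto (fun t : ℝ => x + t • (mid k i - x)) (nhdsWithin 0 (Set.Ioi 0))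
      (nhds x) := by
    have : Continuous fun t : ℝ => x + t • (mid k i - x) := by fun_prop
    simpa using (this.tendsto 0).mono_left nhdsWithin_le_nhds
  refine mem_closure_of_tendsto ht ?_
  filter_upwards [Ioo_mem_nhdsGT (zero_lt_one' ℝ)] with t ht
  have hk : (x + t • (mid k i - x)) k = x k + t * (i + 1 / 2 - x k) := by
    simp [mid_apply]
  refine ⟨hx.1.imp_right fun h => ?_, hx.2.imp_right fun h => ?_⟩ <;> rw [hk] <;>
    nlinarith [ht.1, ht.2]

theorem reg_cell (i : ℕ) : reg (cell k N i) = cell k N i :=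
  subset_antisymm (closure_minimal interior_subset (isClosed_cell k N i))
    ((cell_subset_closure k N i).trans
      (closure_mono (interior_maximal (openSlab_subset_cell k N i) (isOpen_openSlab k N i i))))

theorem isPolytope_cell (i : ℕ) : IsPolytope (cell k N i) := by
  refine IsBasicPolytope.isPolytope ⟨{H | (i ≠ 0 ∧ H = {x | inner ℝ
    (EuclideanSpace.single k (-1 : ℝ)) x ≤ -(i : ℝ)}) ∨
    (i ≠ N ∧ H = {x | inner ℝ (EuclideanSpace.single k (1 : ℝ)) x ≤ (i : ℝ) + 1})}, ?_, ?_, ?_⟩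
  · refine (Set.toFinite {{x | inner ℝ (EuclideanSpace.single k (-1 : ℝ)) x ≤ -(i : ℝ)},
      {x | inner ℝ (EuclideanSpace.single k (1 : ℝ)) x ≤ (i : ℝ) + 1}}).subset ?_
    rintro H (⟨-, h⟩ | ⟨-, h⟩)
    exacts [Or.inl h, Or.inr h]
  · rintro H (⟨-, rfl⟩ | ⟨-, rfl⟩)
    exacts [⟨_, _, by simp, rfl⟩, ⟨_, _, by simp, rfl⟩]
  · conv_lhs => rw [← reg_cell]
    congr 1
    ext x
    simp only [cell, Set.mem_ofPred_eq, Set.mem_sInter, or_imp, forall_and, and_imp,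
      forall_eq_apply_imp_iff, EuclideanSpace.inner_single_left]
    simp only [or_iff_not_imp_left]
    simp

/-- The union of the cells whose index lies in `I`. -/
def cells (I : Set ℕ) : Set (EuclideanSpace ℝ (Fin n)) :=
  {x | ∃ i ≤ N, i ∈ I ∧ x ∈ cell k N i}

theorem cells_eq_biUnion (I : Set ℕ) :
    (cells k N I : Set (EuclideanSpace ℝ (Fin n))) = ⋃ i ∈ {i | i ≤ N ∧ i ∈ I}, cell k N i := by
  ext x
  simp [cells, and_assoc]

theorem isPolytope_cells (I : Set ℕ) : IsPolytope (cells k N I) := by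
  have hfin : {i | i ≤ N ∧ i ∈ I}.Finite := (Set.finite_Iic N).subset fun i hi => hi.1
  rw [cells_eq_biUnion]
  generalize {i | i ≤ N ∧ i ∈ I} = K at hfin ⊢
  induction K, hfin using Set.Finite.induction_on with
  | empty => simpa using isPolytope_empty
  | insert _ _ ih =>
    rw [Set.biUnion_insert]
    exact (isPolytope_cell k N _).union ih

theorem cells_union (I J : Set ℕ) : cells k N I ∪ cells k N J = cells k N (I ∪ J) := by
  ext x
  constructor
  · rintro (⟨i, hi, hI, hx⟩ | ⟨i, hi, hI, hx⟩)
    exacts [⟨i, hi, Or.inl hI, hx⟩, ⟨i, hi, Or.inr hI, hx⟩]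
  · rintro ⟨i, hi, hI | hI, hx⟩
    exacts [Or.inl ⟨i, hi, hI, hx⟩, Or.inr ⟨i, hi, hI, hx⟩]

theorem exists_mem_cell (x : EuclideanSpace ℝ (Fin n)) : ∃ i ≤ N, x ∈ cell k N i := by
  by_cases h : ⌊x k⌋₊ ≤ N
  · refine ⟨⌊x k⌋₊, h, ?_, Or.inr (Nat.lt_floor_add_one _).le⟩
    rcases le_or_gt 0 (x k) with h0 | h0
    exacts [Or.inr (Nat.floor_le h0), Or.inl (Nat.floor_of_nonpos h0.le)]
  · refine ⟨N, le_rfl, Or.inr ?_, Or.inl rfl⟩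
    exact (Nat.lt_of_lt_floor (not_le.1 h)).le

variable {k N} in
/-- Cells with a common point are equal or neighbours. -/
theorem le_succ_of_mem_cell {i j : ℕ} (hi : i ≤ N) {x : EuclideanSpace ℝ (Fin n)}
    (hxi : x ∈ cell k N i) (hxj : x ∈ cell k N j) : i ≤ j + 1 := by
  by_contra! h
  have h1 := hxi.1.resolve_left (by omega)
  have h2 := hxj.2.resolve_left (by omega)
  have h3 : ((j + 1 : ℕ) : ℝ) < i := by exact_mod_cast h
  push_cast at h3
  linarith

variable {k N} in
theorem eq_of_mem_openSlab {i j : ℕ} (hi : i ≤ N) (hj : j ≤ N) {x : EuclideanSpace ℝ (Fin n)}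
    (hxi : x ∈ openSlab k N i i) (hxj : x ∈ cell k N j) : i = j := by
  rcases lt_trichotomy i j with h | h | h
  · have h1 := hxi.2.resolve_left (by omega)
    have h2 := hxj.1.resolve_left (by omega)
    have h3 : ((i + 1 : ℕ) : ℝ) ≤ j := by exact_mod_cast h
    push_cast at h3
    linarith
  · exact h
  · have h1 := hxi.1.resolve_left (by omega)
    have h2 := hxj.2.resolve_left (by omega)
    have h3 : ((j + 1 : ℕ) : ℝ) ≤ i := by exact_mod_cast h
    push_cast at h3
    linarith

theorem regCompl_cells (I : Set ℕ) : regCompl (cells k N I) = cells k N Iᶜ := by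
  apply subset_antisymm
  · refine closure_minimal (fun x hx => ?_) (isPolytope_cells k N Iᶜ).isClosed
    obtain ⟨i, hi, hxi⟩ := exists_mem_cell k N x
    exact ⟨i, hi, fun hI => hx ⟨i, hi, hI, hxi⟩, hxi⟩
  · rintro x ⟨i, hi, hI, hx⟩
    refine closure_mono ?_ (cell_subset_closure k N i hx)
    rintro y hy ⟨j, hj, hJ, hyj⟩
    exact hI (eq_of_mem_openSlab hi hj hy hyj ▸ hJ)

theorem mid_mem_cells {i : ℕ} (hi : i ≤ N) (I : Set ℕ) : mid k i ∈ cells k N I ↔ i ∈ I := by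
  have h := mid_mem_openSlab k N (le_refl i) (le_refl i)
  refine ⟨?_, fun hI => ⟨i, hi, hI, openSlab_subset_cell k N i h⟩⟩
  rintro ⟨j, hj, hJ, hmem⟩
  exact eq_of_mem_openSlab hi hj h hmem ▸ hJ

theorem cells_eq_cells (I J : Set ℕ) :
    cells k N I = cells k N J ↔ ∀ i ≤ N, i ∈ I ↔ i ∈ J := by
  constructor
  · intro h i hi
    rw [← mid_mem_cells k N hi, h, mid_mem_cells k N hi]
  · intro h
    ext x
    exact exists_congr fun i => and_congr_right fun hi => and_congr_left fun _ => h i hi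

/-- Unions of cells are in strong contact if and only if they contain equal or neighbouring
cells. -/
theorem SC_cells (I J : Set ℕ) : SC (cells k N I) (cells k N J) ↔
    ∃ i ≤ N, ∃ j ≤ N, i ∈ I ∧ j ∈ J ∧ i ≤ j + 1 ∧ j ≤ i + 1 := by
  constructor
  · rintro ⟨E, -, hEc, hE, hEI, hEJ⟩
    obtain ⟨x, -, ⟨i, hi, hI, hxi⟩, j, hj, hJ, hxj⟩ :=
      isPreconnected_closed_iff.1 hEc.isPreconnected _ _ (isPolytope_cells k N I).isClosed
        (isPolytope_cells k N J).isClosed hE hEI hEJ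
    exact ⟨i, hi, j, hj, hI, hJ, le_succ_of_mem_cell hi hxi hxj, le_succ_of_mem_cell hj hxj hxi⟩
  · have key : ∀ (I J : Set ℕ) (i j : ℕ), j ≤ N → i ∈ I → j ∈ J → i ≤ j → j ≤ i + 1 →
        SC (cells k N I) (cells k N J) := by
      intro I J i j hj hI hJ hij hji
      have hi := hij.trans hj
      have h1 := mid_mem_openSlab k N le_rfl hij
      have h2 := mid_mem_openSlab k N hij le_rfl
      refine ⟨openSlab k N i j, isOpen_openSlab k N i j,
        ⟨⟨_, h1⟩, (convex_openSlab k N i j).isPreconnected⟩, fun x hx => ?_,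
        ⟨_, h1, (mid_mem_cells k N hi I).2 hI⟩, ⟨_, h2, (mid_mem_cells k N hj J).2 hJ⟩⟩
      rcases le_or_gt (x k) (i + 1) with h | h
      · exact Or.inl ⟨i, hi, hI, hx.1.imp_right le_of_lt, Or.inr h⟩
      · refine Or.inr ⟨j, hj, hJ, Or.inr ?_, hx.2.imp_right le_of_lt⟩
        have : (j : ℝ) ≤ i + 1 := by exact_mod_cast hji
        linarith
    rintro ⟨i, hi, j, hj, hI, hJ, h1, h2⟩
    rcases le_total i j with h | h
    exacts [key I J i j hj hI hJ h h2, (key J I j i hi hJ hI h h1).symm]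

end Slabs

/-! ### Completeness -/

section Completeness

variable {n : ℕ} (k : Fin n) (N : ℕ) (f : ℕ → Finset ℕ)

/-- The valuation that places the vertices of a walk `f 0, …, f N` in consecutive cells. -/
def walkValuation (i : ℕ) : (PSC n).carrier :=
  ⟨cells k N {j | i ∈ f j}, isPolytope_cells k N _⟩

theorem value_walkValuation (a : Term) :
    (value (walkValuation k N f) a).1 = cells k N {j | a.Holds (f j)} := by
  induction a with
  | var i => rfl
  | compl a ih => rw [coe_value_compl, ih, regCompl_cells]; rfl
  | join a b iha ihb => rw [coe_value_join, iha, ihb, cells_union]; rfl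

/-- A walk through all edges of a reflexive symmetric graph transfers the truth of formulas from the
graph to the polytopes. -/
theorem trueUnder_walkValuation {W : Set (Finset ℕ)} {r : Finset ℕ → Finset ℕ → Prop}
    (hrefl : ∀ s ∈ W, r s s) (hsymm : ∀ s t, r s t → r t s) (hfW : ∀ i ≤ N, f i ∈ W)
    (hf : ∀ i < N, r (f i) (f (i + 1))) (hcov : ∀ s t, r s t → ∃ i < N, f i = s ∧ f (i + 1) = t)
    (φ : Formula) : φ.TrueUnder (PSC n) (walkValuation k N f) ↔ φ.HoldsIn W r := by
  induction φ with
  | eq a b =>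
    have h : Formula.TrueUnder (PSC n) (walkValuation k N f) (.eq a b) ↔
        (value (walkValuation k N f) a).1 = (value (walkValuation k N f) b).1 :=
      Subtype.ext_iff (a1 := value (walkValuation k N f) a)
    rw [h, value_walkValuation, value_walkValuation, cells_eq_cells]
    refine ⟨fun h s hs => ?_, fun h i hi => h _ (hfW i hi)⟩
    obtain ⟨i, hi, rfl, -⟩ := hcov s s (hrefl s hs)
    exact h i hi.le
  | contact a b =>
    have h : Formula.TrueUnder (PSC n) (walkValuation k N f) (.contact a b) ↔
        SC (value (walkValuation k N f) a).1 (value (walkValuation k N f) b).1 := Iff.rfl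
    rw [h, value_walkValuation, value_walkValuation, SC_cells]
    constructor
    · rintro ⟨i, hi, j, hj, ha, hb, hij, hji⟩
      refine ⟨f i, f j, ?_, ha, hb⟩
      rcases lt_trichotomy i j with hlt | rfl | hlt
      · obtain rfl : j = i + 1 := by omega
        exact hf i hj
      · exact hrefl _ (hfW i hi)
      · obtain rfl : i = j + 1 := by omega
        exact hsymm _ _ (hf j hi)
    · rintro ⟨s, t, hst, ha, hb⟩
      obtain ⟨i, hi, rfl, rfl⟩ := hcov s t hst
      exact ⟨i, hi.le, i + 1, hi, ha, hb, by omega, by omega⟩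
  | neg φ ih => exact not_congr ih
  | disj φ ψ ih1 ih2 => exact or_congr ih1 ih2

theorem isTheorem_of_trueIn (hn : 0 < n) {φ : Formula} (h : φ.TrueIn (PSC n)) : IsTheorem φ := by
  by_contra hφ
  obtain ⟨T, hT, hφT⟩ := exists_isMaximalTheory hφ
  have hC := Lindenbaum.isConnectedContact hT
  have hfin : (vertices hT φ.vars).Finite :=
    φ.vars.powerset.finite_toSet.subset fun s hs => Finset.mem_coe.2 (Finset.mem_powerset.2 hs.1)
  obtain ⟨f, N, hfW, hf, hcov⟩ := exists_walk (r := Edge hT φ.vars) hfin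
    (vertices_nonempty hT φ.vars)
    (fun s t hst => ⟨⟨hst.1.1, hC.ne_bot_left hst.2⟩, hst.1.2, hC.ne_bot_left (hC.symm hst.2)⟩)
    (fun s hs t ht => hC.reflTransGen_minterm hs.1 ht.1 hs.2 ht.2)
  refine hφT ((mem_iff_holdsIn φ subset_rfl).2 ((trueUnder_walkValuation ⟨0, hn⟩ N f ?_ ?_ hfW hf
    hcov φ).1 (h _)))
  · exact fun s hs => ⟨⟨hs.1, hs.1⟩, hC.self hs.2⟩
  · exact fun s t hst => ⟨⟨hst.1.2, hst.1.1⟩, hC.symm hst.2⟩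

end Completeness

end StrongContact

theorem mainTheorem2 (n : ℕ) (hn : 0 < n) :
    (∀ φ : StrongContact.Formula,
      φ.TrueIn (StrongContact.PSC n) → StrongContact.IsTheorem φ) ∧
    StrongContact.universalFragment (StrongContact.PSC n) = StrongContact.theorems :=
  ⟨fun _ h => StrongContact.isTheorem_of_trueIn hn h, Set.ext fun _ =>
    ⟨fun h => StrongContact.isTheorem_of_trueIn hn h, fun h => h.trueIn hn⟩⟩
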